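/- **Setting.** Let $d,r,k,k_{\mathscr I},k_{\mathcal I}$ be non-negative integers with $k\le r$, let $T>0$, $u_0\in\mathbb R^d$, $\|\cdot\|$ the Euclidean norm, $P_m$ the polynomials of degree at most $m$ ($P_{-1}=\{0\}$), and $k_{\mathcal J}:=\max\{\lfloor k/2\rfloor-1,k_{\mathscr I},k_{\mathcal I}\}$. Let $f:[t_0,t_0+T]\times\mathbb R^d\to\mathbb R^d$ be of class $C^{\max\{k_{\mathcal J},\,r+1\}}$ and Lipschitz in its second argument, uniformly in $t$, and let $u$ solve $u'(t)=f(t,u(t))$ on $[t_0,t_0+T]$, $u(t_0)=u_0$. Let $\widehat{\mathscr I}$ be a linear functional on $C^{k_{\mathscr I}}([-1,1])$ and $\widehat{\mathcal I}$ a linear operator from $C^{k_{\mathcal I}}([-1,1])$ to functions on $[-1,1]$ with $\widehat{\mathcal I}v\in C^l([-1,1])$ for all $v\in C^{\max\{k_{\mathcal I},l\}}([-1,1])$ and all integers $l\ge 0$. For $J=[a,b]$, $a<b$, put $T_J(x)=\frac{a+b}2+\frac{b-a}2x$, $\mathscr I_J[\varphi]=\frac{b-a}2\widehat{\mathscr I}[\varphi\circ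 T_J]$ and $\mathcal I_J\varphi=(\widehat{\mathcal I}(\varphi\circ T_J))\circ T_J^{-1}$. All operators act componentwise on vector-valued functions. **The method.** For a mesh $t_0<t_1<\dots<t_N=t_0+T$ let $I_n=(t_{n-1},t_n]$, $\tau_n=t_n-t_{n-1}$, $\tau=\max_n\tau_n$, $\mathscr I_n=\mathscr I_{\overline I_n}$, $\mathcal I_n=\mathcal I_{\overline I_n}$. A discrete solution is a function $U$ with $U(t_0^-)=u_0$ and $U|_{I_n}\in P_r(I_n,\mathbb R^d)$ such that for $n=1,\dots,N$: - $U(t_{n-1}^+)=U(t_{n-1}^-)$ if $k\ge1$; - $U^{(i+1)}(t_n^-)=\frac{d^i}{dt^i}f(t,U(t))\big|_{t=t_n^-}$ for $0\le i\le\lfloor\frac k2\rfloor-1$, if $k\ge 2$; - $U^{(i+1)}(t_{n-1}^+)=\frac{d^i}{dt^i}f(t,U(t))\big|_{t=t_{n-1}^+}$ for $0\le i\le\lfloor\frac{k-1}2\rfloor-1$, if $k\ge3$; - $\mathscr I_n[(U',\varphi)]+\delta_{0,k}\big(U(t_{n-1}^+)-U(t_{n-1}^-),\varphi(t_{n-1}^+)\big)=\mathscr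 I_n[(\mathcal I_nf(\cdot,U(\cdot)),\varphi)]$ for all $\varphi\in P_{r-k}(I_n,\mathbb R^d)$. **Assumptions.** There are constants $\mathfrak C$ (possibly different in each item) such that: 1. If $\psi\in P_{r-\max\{1,k\}}$ and $\widehat{\mathscr I}\big[(1-x)^{\lfloor k/2\rfloor}(1+x)^{|\lfloor (k-1)/2\rfloor|}\psi\varphi\big]=0$ for all $\varphi\in P_{r-\max\{1,k\}}$, then $\psi=0$. 2. $\|\widehat{\mathscr I}[\varphi]\|\le\mathfrak C\sum_{j=0}^{k_{\mathscr I}}\sup_{[-1,1]}\|\varphi^{(j)}\|$ for all $\varphi\in C^{k_{\mathscr I}}([-1,1],\mathbb R^d)$. 3. For $0\le l\le k_{\mathscr I}$: $\sup_{[-1,1]}\|(\widehat{\mathcal I}\varphi)^{(l)}\|\le\mathfrak C\sum_{j=0}^{\max\{k_{\mathcal I},l\}}\sup_{[-1,1]}\|\varphi^{(j)}\|$ for all $\varphi\in C^{\max\{k_{\mathcal I},l\}}([-1,1],\mathbb R^d)$. 4. For $0\le i\le k_{\mathcal J}$ and all $v,w\in C^{k_{\mathcal J}}([t_0,t_0+T],\mathbb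 R^d)$: $\big\|\frac{d^i}{dt^i}\big(f(t,v(t))-f(t,w(t))\big)\big|_{t=s}\big\|\le\mathfrak C\sum_{l=0}^i\|(v-w)^{(l)}(s)\|$ for a.e. $s\in[t_0,t_0+T]$. 5. One of the following holds, where for distinct points $x_0,\dots,x_K\in[-1,1]$ and $\kappa\in\mathbb N_0^{K+1}$ we write $\Sigma^{x,\kappa}_J(\varphi)=\sum_{m=0}^K\sum_{j=0}^{\kappa_m}\big(\tfrac{b-a}2\big)^j\|\varphi^{(j)}(T_J(x_m))\|$, and where the points, orders and constants do not depend on $J$: - (a) There are such $x,\kappa$ with all $\kappa_m\le k_{\mathcal I}$ such that for all $J=[a,b]$, $0\le l\le k_{\mathscr I}$ and $\varphi\in C^{k_{\mathcal I}}(J,\mathbb R^d)$ we have $\mathcal I_J\varphi\in C^l(J,\mathbb R^d)$ and $\big(\frac{b-a}2\big)^l\sup_{(a,b]}\|(\mathcal I_J\varphi)^{(l)}\|\le\mathfrak C_{1}\Sigma^{x,\kappa}_J(\varphi)+\mathfrak C_{2}\sup_{(a,b]}\|\varphi\|$; or - (b) there are such $y,\lambda$ and $x,\kappa$ with all $\lambda_m\le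 k_{\mathscr I}$ and all $\kappa_m\le\max\{k_{\mathscr I},k_{\mathcal I}\}$ such that for all $J=[a,b]$: $\|\mathscr I_J[\varphi]\|\le\frac{b-a}2\big(\mathfrak C_{1}\Sigma^{y,\lambda}_J(\varphi)+\mathfrak C_{2}\sup_{(a,b]}\|\varphi\|\big)$ for all $\varphi\in C^{k_{\mathscr I}}(J,\mathbb R^d)$, and $\Sigma^{y,\lambda}_J(\mathcal I_J\varphi)+\sup_{(a,b]}\|\mathcal I_J\varphi\|\le\mathfrak C_{3}\Sigma^{x,\kappa}_J(\varphi)+\mathfrak C_{4}\sup_{(a,b]}\|\varphi\|$ for all $\varphi\in C^{\max\{k_{\mathscr I},k_{\mathcal I}\}}(J,\mathbb R^d)$. **Orders.** Let $r_{\mathrm{ex}}^{\mathscr I}$ and $r_{\mathcal I,i}^{\mathscr I}$ ($i\ge 0$) in $\{-1,0,1,\dots,\infty\}$ be the largest numbers such that, on every interval $J=[a,b]$, $\int_J\varphi\,dt=\mathscr I_J[\varphi]$ for all $\varphi\in P_{r_{\mathrm{ex}}^{\mathscr I}}$, and $\mathscr I_J[\varphi\psi]=\mathscr I_J[(\mathcal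 I_J\varphi)\psi]$ for all $\varphi\in P_{r_{\mathcal I,i}^{\mathscr I}}$, $\psi\in P_i$, respectively. Put $r_{\mathcal I}^{\mathscr I}:=r_{\mathcal I,r-k}^{\mathscr I}$. **Claim.** There are $\tau_*>0$ and $C>0$, independent of the mesh, such that for every mesh with $\tau\le\tau_*$, every discrete solution $U$, every $1\le n\le N$ and $l\in\{0,1\}$, $$\sup_{t\in I_n}\|(u-U)^{(l)}(t)\|\le C\,\tau^{\min\{r,\;r_{\mathcal I}^{\mathscr I}+1\}},$$ and, if moreover $\max\{r_{\mathrm{ex}}^{\mathscr I},r_{\mathcal I}^{\mathscr I}+1\}\ge r-1$, $$\sup_{t\in I_n}\|(u-U)(t)\|\le C\,\tau^{\min\{r+1,\;r_{\mathcal I}^{\mathscr I}+2,\;r_{\mathcal I,0}^{\mathscr I}+1,\;\max\{r_{\mathrm{ex}}^{\mathscr I}+1,\,\min\{r,\,r_{\mathcal I}^{\mathscr I}+1\}\}\}}.$$ -/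

import Mathlib

open Set MeasureTheory Polynomial

noncomputable section

/-- The state space `ℝ^d` with the Euclidean norm. -/
abbrev Vec (d : ℕ) := EuclideanSpace ℝ (Fin d)

/-- Supremum over `S` of the norm of `g`. -/
def supOn {E : Type*} [Norm E] (S : Set ℝ) (g : ℝ → E) : ℝ :=
  sSup ((fun t => ‖g t‖) '' S)

/-- The affine map of `[-1,1]` onto `[a,b]`. -/
def affineMap (a b x : ℝ) : ℝ := (b + a) / 2 + (b - a) / 2 * x

/-- The inverse of `affineMap a b`. -/
def affineInv (a b t : ℝ) : ℝ := (2 * t - (b + a)) / (b - a)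

/-- `Q` is a linear functional on `C^kI([-1,1])`. A function on `[-1,1]` is represented by any
function on `ℝ` that extends it; the values of `Q` off `C^kI([-1,1])` are irrelevant. -/
structure IsRefIntegrator (kI : ℕ) (Q : (ℝ → ℝ) → ℝ) : Prop where
  congr : ∀ φ ψ : ℝ → ℝ, ContDiffOn ℝ kI φ (Icc (-1) 1) → EqOn φ ψ (Icc (-1) 1) → Q φ = Q ψ
  add : ∀ φ ψ : ℝ → ℝ, ContDiffOn ℝ kI φ (Icc (-1) 1) → ContDiffOn ℝ kI ψ (Icc (-1) 1) →
    Q (fun x => φ x + ψ x) = Q φ + Q ψ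
  smul : ∀ (c : ℝ) (φ : ℝ → ℝ), ContDiffOn ℝ kI φ (Icc (-1) 1) → Q (fun x => c * φ x) = c * Q φ

/-- `A` is a linear operator from `C^kA([-1,1])` to the functions on `[-1,1]` whose values are at
least as smooth as its arguments. -/
structure IsRefApproximation (kA : ℕ) (A : (ℝ → ℝ) → ℝ → ℝ) : Prop where
  congr : ∀ φ ψ : ℝ → ℝ, ContDiffOn ℝ kA φ (Icc (-1) 1) → EqOn φ ψ (Icc (-1) 1) →
    EqOn (A φ) (A ψ) (Icc (-1) 1)
  add : ∀ φ ψ : ℝ → ℝ, ContDiffOn ℝ kA φ (Icc (-1) 1) → ContDiffOn ℝ kA ψ (Icc (-1) 1) →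
    EqOn (A (fun x => φ x + ψ x)) (fun x => A φ x + A ψ x) (Icc (-1) 1)
  smul : ∀ (c : ℝ) (φ : ℝ → ℝ), ContDiffOn ℝ kA φ (Icc (-1) 1) →
    EqOn (A (fun x => c * φ x)) (fun x => c * A φ x) (Icc (-1) 1)
  smooth : ∀ (l : ℕ) (φ : ℝ → ℝ), ContDiffOn ℝ (max kA l : ℕ) φ (Icc (-1) 1) →
    ContDiffOn ℝ l (A φ) (Icc (-1) 1)

/-- The local integrator on `[a,b]`. -/
def localInt (Q : (ℝ → ℝ) → ℝ) (a b : ℝ) (φ : ℝ → ℝ) : ℝ :=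
  (b - a) / 2 * Q (fun x => φ (affineMap a b x))

/-- The local approximation operator on `[a,b]`. -/
def localApprox (A : (ℝ → ℝ) → ℝ → ℝ) (a b : ℝ) (ψ : ℝ → ℝ) : ℝ → ℝ :=
  fun t => A (fun x => ψ (affineMap a b x)) (affineInv a b t)

/-- Componentwise application of a functional to a vector-valued function. -/
def vecInt {d : ℕ} (Q : (ℝ → ℝ) → ℝ) (φ : ℝ → Vec d) : Vec d :=
  WithLp.toLp 2 (fun i => Q (fun t => φ t i))

/-- Componentwise application of an operator to a vector-valued function. -/
def vecApprox {d : ℕ} (A : (ℝ → ℝ) → ℝ → ℝ) (φ : ℝ → Vec d) : ℝ → Vec d :=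
  fun t => WithLp.toLp 2 (fun i => A (fun s => φ s i) t)

/-- `ℝ^d`-valued polynomials of degree at most `m`. -/
def IsVecPoly {d : ℕ} (m : ℕ) (p : ℝ → Vec d) : Prop :=
  ∃ c : ℕ → Vec d, p = fun t => ∑ j ∈ Finset.range (m + 1), t ^ j • c j

/-- `max {⌊k/2⌋ - 1, kI, kA}`; the truncated subtraction is harmless since `kI ≥ 0`. -/
def kJ (k kI kA : ℕ) : ℕ := max (k / 2 - 1) (max kI kA)

/-! ### The initial value problem and its discretization -/

/-- `u` solves `u' = f(t,u)` on `[t₀, t₀+T]` with `u(t₀) = u₀`. -/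
def IsIVPSolution {d : ℕ} (t₀ T : ℝ) (f : ℝ → Vec d → Vec d) (u₀ : Vec d) (u : ℝ → Vec d) : Prop :=
  u t₀ = u₀ ∧ ∀ t ∈ Icc t₀ (t₀ + T), HasDerivWithinAt u (f t (u t)) (Icc t₀ (t₀ + T)) t

/-- `t 0 < t 1 < ⋯ < t N` is a mesh of `[t₀, t₀+T]`. -/
def IsMesh (t₀ T : ℝ) (N : ℕ) (t : ℕ → ℝ) : Prop :=
  t 0 = t₀ ∧ t N = t₀ + T ∧ ∀ n < N, t n < t (n + 1)

/-- The largest length of a mesh interval. -/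
def meshSize (N : ℕ) (t : ℕ → ℝ) : ℝ := ⨆ n : Fin N, (t (n + 1) - t n)

/-- The local problem on `(a,b]` with left value `Ua` for a polynomial `p` of degree at most `r`. -/
structure IsLocalSolution {d : ℕ} (r k : ℕ) (Q : (ℝ → ℝ) → ℝ) (A : (ℝ → ℝ) → ℝ → ℝ)
    (f : ℝ → Vec d → Vec d) (a b : ℝ) (Ua : Vec d) (p : ℝ → Vec d) : Prop where
  poly : IsVecPoly r p
  initial : 1 ≤ k → p a = Ua
  right : ∀ i < k / 2,
    iteratedDeriv (i + 1) p b = iteratedDerivWithin i (fun t => f t (p t)) (Icc a b) b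
  left : ∀ i < (k - 1) / 2,
    iteratedDeriv (i + 1) p a = iteratedDerivWithin i (fun t => f t (p t)) (Icc a b) a
  variational : ∀ φ : ℝ → Vec d, IsVecPoly (r - k) φ →
    localInt Q a b (fun t => inner ℝ (deriv p t) (φ t))
        + (if k = 0 then inner ℝ (p a - Ua) (φ a) else 0)
      = localInt Q a b
          (fun t => inner ℝ (vecApprox (localApprox A a b) (fun s => f s (p s)) t) (φ t))

/-- `U` is a discrete solution. On `(t n, t (n+1)]` it is a polynomial that solves the local problem.
As these intervals are closed on the right, the left limit of `U` at `t n` is `U (t n)`;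
`U (t 0)` stands for `U(t₀⁻) = u₀`. -/
def IsDiscreteSolution {d : ℕ} (r k : ℕ) (Q : (ℝ → ℝ) → ℝ) (A : (ℝ → ℝ) → ℝ → ℝ)
    (f : ℝ → Vec d → Vec d) (u₀ : Vec d) (N : ℕ) (t : ℕ → ℝ) (U : ℝ → Vec d) : Prop :=
  U (t 0) = u₀ ∧ ∀ n < N, ∃ p : ℝ → Vec d, EqOn U p (Ioc (t n) (t (n + 1))) ∧
    IsLocalSolution r k Q A f (t n) (t (n + 1)) (U (t n)) p

/-! ### The assumptions -/

/-- Unisolvence of the integrator: `ψ ∈ P_{r - max{1,k}}` vanishes if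
`Q[(1-x)^⌊k/2⌋ (1+x)^|⌊(k-1)/2⌋| ψ φ] = 0` for all `φ ∈ P_{r - max{1,k}}`.
`degreeLT ℝ m` is `P_{m-1}`, with `P_{-1} = {0}`. -/
def AssIntegrator (r k : ℕ) (Q : (ℝ → ℝ) → ℝ) : Prop :=
  ∀ ψ ∈ degreeLT ℝ (r + 1 - max 1 k),
    (∀ φ ∈ degreeLT ℝ (r + 1 - max 1 k),
      Q (fun x => (1 - x) ^ (k / 2) * (1 + x) ^ (if k = 0 then 1 else (k - 1) / 2)
        * ψ.eval x * φ.eval x) = 0) → ψ = 0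

/-- Boundedness of the integrator. -/
def AssSupIntegrator (d kI : ℕ) (Q : (ℝ → ℝ) → ℝ) : Prop :=
  ∃ C₀ : ℝ, ∀ φ : ℝ → Vec d, ContDiffOn ℝ kI φ (Icc (-1) 1) →
    ‖vecInt Q φ‖ ≤ C₀ * ∑ j ∈ Finset.range (kI + 1),
      supOn (Icc (-1) 1) (iteratedDerivWithin j φ (Icc (-1) 1))

/-- Boundedness of the approximation operator. -/
def AssSupApprox (d kI kA : ℕ) (A : (ℝ → ℝ) → ℝ → ℝ) : Prop :=
  ∃ C₁ : ℝ, ∀ l ≤ kI, ∀ φ : ℝ → Vec d, ContDiffOn ℝ (max kA l : ℕ) φ (Icc (-1) 1) →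
    supOn (Icc (-1) 1) (iteratedDerivWithin l (vecApprox A φ) (Icc (-1) 1))
      ≤ C₁ * ∑ j ∈ Finset.range (max kA l + 1),
          supOn (Icc (-1) 1) (iteratedDerivWithin j φ (Icc (-1) 1))

/-- Lipschitz-type condition for the derivatives of `f(t,v(t))` up to order `K`. -/
def AssDiff {d : ℕ} (K : ℕ) (t₀ T : ℝ) (f : ℝ → Vec d → Vec d) : Prop :=
  ∃ C₂ : ℝ, ∀ i ≤ K, ∀ v w : ℝ → Vec d,
    ContDiffOn ℝ K v (Icc t₀ (t₀ + T)) → ContDiffOn ℝ K w (Icc t₀ (t₀ + T)) →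
    ∀ᵐ s ∂(volume.restrict (Icc t₀ (t₀ + T))),
      ‖iteratedDerivWithin i (fun t => f t (v t) - f t (w t)) (Icc t₀ (t₀ + T)) s‖
        ≤ C₂ * ∑ l ∈ Finset.range (i + 1),
            ‖iteratedDerivWithin l (fun t => v t - w t) (Icc t₀ (t₀ + T)) s‖

/-- `∑_m ∑_{j ≤ κ m} ((b-a)/2)^j ‖φ^{(j)}(t_m)‖`, `t_m` the image of `x m` in `[a,b]`. -/
def pointSum {d K : ℕ} (x : Fin (K + 1) → ℝ) (κ : Fin (K + 1) → ℕ) (a b : ℝ)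
    (φ : ℝ → Vec d) : ℝ :=
  ∑ m, ∑ j ∈ Finset.range (κ m + 1),
    ((b - a) / 2) ^ j * ‖iteratedDerivWithin j φ (Icc a b) (affineMap a b (x m))‖

/-- First version of the point value assumption. The points and the constants do not depend on the
interval; only derivatives that exist are evaluated. -/
def AssPointA (d kI kA : ℕ) (A : (ℝ → ℝ) → ℝ → ℝ) : Prop :=
  ∃ (K : ℕ) (x : Fin (K + 1) → ℝ) (κ : Fin (K + 1) → ℕ) (C₁₁ C₁₂ : ℝ),
    Function.Injective x ∧ (∀ m, x m ∈ Icc (-1 : ℝ) 1) ∧ (∀ m, κ m ≤ kA) ∧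
    ∀ a b : ℝ, a < b → ∀ φ : ℝ → Vec d, ContDiffOn ℝ kA φ (Icc a b) → ∀ l ≤ kI,
      ContDiffOn ℝ l (vecApprox (localApprox A a b) φ) (Icc a b) ∧
      ((b - a) / 2) ^ l *
          supOn (Ioc a b) (iteratedDerivWithin l (vecApprox (localApprox A a b) φ) (Icc a b))
        ≤ C₁₁ * pointSum x κ a b φ + C₁₂ * supOn (Ioc a b) φ

/-- Second version of the point value assumption. -/
def AssPointB (d kI kA : ℕ) (Q : (ℝ → ℝ) → ℝ) (A : (ℝ → ℝ) → ℝ → ℝ) : Prop :=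
  ∃ (L : ℕ) (y : Fin (L + 1) → ℝ) (lam : Fin (L + 1) → ℕ) (C₀₁ C₀₂ : ℝ)
    (K : ℕ) (x : Fin (K + 1) → ℝ) (κ : Fin (K + 1) → ℕ) (C₁₁ C₁₂ : ℝ),
    Function.Injective y ∧ (∀ m, y m ∈ Icc (-1 : ℝ) 1) ∧ (∀ m, lam m ≤ kI) ∧
    Function.Injective x ∧ (∀ m, x m ∈ Icc (-1 : ℝ) 1) ∧ (∀ m, κ m ≤ max kI kA) ∧
    ∀ a b : ℝ, a < b →
      (∀ φ : ℝ → Vec d, ContDiffOn ℝ kI φ (Icc a b) →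
        ‖vecInt (localInt Q a b) φ‖
          ≤ C₀₁ * ((b - a) / 2) * pointSum y lam a b φ
            + C₀₂ * ((b - a) / 2) * supOn (Ioc a b) φ) ∧
      (∀ φ : ℝ → Vec d, ContDiffOn ℝ (max kI kA : ℕ) φ (Icc a b) →
        pointSum y lam a b (vecApprox (localApprox A a b) φ)
            + supOn (Ioc a b) (vecApprox (localApprox A a b) φ)
          ≤ C₁₁ * pointSum x κ a b φ + C₁₂ * supOn (Ioc a b) φ)

/-! ### Approximation orders -/

/-- The largest `m ∈ {-1, 0, 1, …, ∞}` such that `H p` holds for all polynomials `p ∈ P_m`, where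
`P_{-1} = {0}`: it is one less than the largest `n ∈ {0, 1, …, ∞}` such that `H p` holds for all
polynomials of degree less than `n`. -/
def largestDegree (H : ℝ[X] → Prop) : WithTop ℤ :=
  ENat.map (fun n : ℕ => (n : ℤ) - 1)
    (⨆ (n : ℕ) (_ : ∀ p ∈ degreeLT ℝ n, H p), (n : ℕ∞))

/-- Degree of exactness of the integrator. -/
def rEx (Q : (ℝ → ℝ) → ℝ) : WithTop ℤ :=
  largestDegree fun p => ∀ a b : ℝ, a < b →
    ∫ t in a..b, p.eval t = localInt Q a b (fun t => p.eval t)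

/-- Largest degree of polynomials `φ` for which the integrator cannot distinguish `φ ψ` from
`(A φ) ψ` for all `ψ ∈ P_i`. -/
def rIA (Q : (ℝ → ℝ) → ℝ) (A : (ℝ → ℝ) → ℝ → ℝ) (i : ℕ) : WithTop ℤ :=
  largestDegree fun p => ∀ a b : ℝ, a < b → ∀ ψ ∈ degreeLT ℝ (i + 1),
    localInt Q a b (fun t => p.eval t * ψ.eval t)
      = localInt Q a b (fun t => localApprox A a b (fun s => p.eval s) t * ψ.eval t)

/-- `min {r, r_{I,r-k} + 1}`. -/
def basicOrder (r k : ℕ) (Q : (ℝ → ℝ) → ℝ) (A : (ℝ → ℝ) → ℝ → ℝ) : WithTop ℤ :=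
  min ((r : ℤ) : WithTop ℤ) (rIA Q A (r - k) + 1)

/-- `min {r+1, r_{I,r-k} + 2, r_{I,0} + 1, max {r_ex + 1, min {r, r_{I,r-k} + 1}}}`. -/
def improvedOrder (r k : ℕ) (Q : (ℝ → ℝ) → ℝ) (A : (ℝ → ℝ) → ℝ → ℝ) : WithTop ℤ :=
  min (((r : ℤ) + 1 : ℤ) : WithTop ℤ) (min (rIA Q A (r - k) + 2)
    (min (rIA Q A 0 + 1) (max (rEx Q + 1) (min ((r : ℤ) : WithTop ℤ) (rIA Q A (r - k) + 1)))))

end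

/-! Everything is pulled back from a mesh interval of length `h` to `[-1,1]` and measured there by
the sup norms of all derivatives up to order `K = kJ k kI kA` (`CkBound`). Let `p` be the local
polynomial, `P` a component of the pulled-back `p'`, and `q` a Taylor polynomial of degree less than
`m = min {r, r_{I,r-k} + 1}` of the same component of `u' = f(t,u)`. Against test functions in
`P_{r-k}` the integrator does not distinguish `q` from `A q`, so `R = P - q` solves the discrete
equations with right-hand side `f(t,p) - q`. Unisolvence says that these equations determine `R`; in
finite dimension this bounds the coefficients of `R`, hence all its derivatives, by the right-hand
side (`exists_stability`).

That right-hand side is `O(h^m)` plus the difference `f(t,u) - f(t,p)`, which the Lipschitz-type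
condition bounds by `u - p` in `C^K`. In turn `u - p` is its initial value plus `h/2` times an
integral of `u' - p'`, which is `R` up to `O(h^m)`. The estimate feeds back into itself with a
factor `h` and closes for small `h` (`exists_local_bound`). For `k = 0` the unknown jump is first
avoided by testing only with polynomials that vanish at `-1`, and then recovered by testing with
`1`.

One step thus turns an error `ε` at the left node into at most `ε + C h (ε + h^m)`
(`exists_local_error`), and a discrete Gronwall argument (`mesh_gronwall`) gives the order `m`. If
`Q` is exact on `P_{r-1}`, testing with `1` writes the change of the error over one step as `h/2 (∫
f(t,u) - Q[A f(t,p)])`. If moreover `∫`, `Q` and `Q ∘ A` agree on `P_m`, a Taylor polynomial of one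
degree more can be inserted, which gains a power of `h`. By `order_arith` the improved order is
either at most `m`, or equal to `m + 1` with these conditions satisfied. -/

/-! ### Functions on `[-1,1]` with bounded derivatives -/

/-- `g` is of class `C^n` on `[-1,1]` and its derivatives up to the order `n` are bounded by `B`. -/
structure CkBound {E : Type*} [NormedAddCommGroup E] [NormedSpace ℝ E] (n : ℕ) (B : ℝ)
    (g : ℝ → E) : Prop where
  smooth : ContDiffOn ℝ n g (Icc (-1) 1)
  bound : ∀ j ≤ n, ∀ x ∈ Icc (-1 : ℝ) 1, ‖iteratedDerivWithin j g (Icc (-1) 1) x‖ ≤ B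

theorem uniqueDiffOn_ref : UniqueDiffOn ℝ (Icc (-1 : ℝ) 1) := uniqueDiffOn_Icc (by norm_num)

/-- Derivatives commute with continuous linear maps. -/
theorem iteratedDerivWithin_clm_comp {E F : Type*} [NormedAddCommGroup E] [NormedSpace ℝ E]
    [NormedAddCommGroup F] [NormedSpace ℝ F] (L : E →L[ℝ] F) {g : ℝ → E} {s : Set ℝ} {j : ℕ}
    (hg : ContDiffOn ℝ j g s) (hs : UniqueDiffOn ℝ s) {x : ℝ} (hx : x ∈ s) :
    iteratedDerivWithin j (fun y => L (g y)) s x = L (iteratedDerivWithin j g s x) := by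
  have := L.iteratedFDerivWithin_comp_left (hg x hx) hs hx (i := j) le_rfl
  simp only [iteratedDerivWithin_eq_iteratedFDerivWithin]
  change iteratedFDerivWithin ℝ j (L ∘ g) s x _ = _
  rw [this]
  rfl

/-- Derivatives on a subset. -/
theorem iteratedDerivWithin_of_subset {E : Type*} [NormedAddCommGroup E] [NormedSpace ℝ E]
    {g : ℝ → E} {s t : Set ℝ} {j : ℕ} (hst : s ⊆ t) (hs : UniqueDiffOn ℝ s)
    (ht : UniqueDiffOn ℝ t) (hg : ContDiffOn ℝ j g t) {x : ℝ} (hx : x ∈ s) :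
    iteratedDerivWithin j g s x = iteratedDerivWithin j g t x := by
  simp only [iteratedDerivWithin_eq_iteratedFDerivWithin]
  rw [iteratedFDerivWithin_subset hst hs ht hg hx]

namespace CkBound

variable {E : Type*} [NormedAddCommGroup E] [NormedSpace ℝ E] {n m : ℕ} {B C : ℝ} {g h : ℝ → E}

theorem nonneg (hg : CkBound n B g) : 0 ≤ B :=
  (norm_nonneg _).trans (hg.bound 0 (Nat.zero_le _) 0 (by simp))

theorem norm_le (hg : CkBound n B g) {x : ℝ} (hx : x ∈ Icc (-1 : ℝ) 1) : ‖g x‖ ≤ B := by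
  simpa using hg.bound 0 (Nat.zero_le _) x hx

theorem weaken (hg : CkBound n B g) (hB : B ≤ C) : CkBound n C g :=
  ⟨hg.smooth, fun j hj x hx => (hg.bound j hj x hx).trans hB⟩

theorem of_le (hg : CkBound n B g) (hm : m ≤ n) : CkBound m B g :=
  ⟨hg.smooth.of_le (by exact_mod_cast hm), fun j hj x hx => hg.bound j (hj.trans hm) x hx⟩

theorem congr (hg : CkBound n B g) (hgh : EqOn h g (Icc (-1) 1)) : CkBound n B h :=
  ⟨hg.smooth.congr hgh, fun j hj x hx => by
    rw [iteratedDerivWithin_congr hgh hx]; exact hg.bound j hj x hx⟩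

theorem smooth_at (hg : CkBound n B g) {j : ℕ} (hj : j ≤ n) {x : ℝ} (hx : x ∈ Icc (-1 : ℝ) 1) :
    ContDiffWithinAt ℝ j g (Icc (-1) 1) x :=
  (hg.smooth x hx).of_le (by exact_mod_cast hj)

theorem add (hg : CkBound n B g) (hh : CkBound n C h) : CkBound n (B + C) (fun x => g x + h x) :=
  ⟨hg.smooth.add hh.smooth, fun j hj x hx => by
    rw [iteratedDerivWithin_fun_add hx uniqueDiffOn_ref (hg.smooth_at hj hx) (hh.smooth_at hj hx)]
    exact (norm_add_le _ _).trans (add_le_add (hg.bound j hj x hx) (hh.bound j hj x hx))⟩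

theorem const_smul (hg : CkBound n B g) (c : ℝ) : CkBound n (|c| * B) (fun x => c • g x) :=
  ⟨hg.smooth.const_smul c, fun j hj x hx => by
    rw [iteratedDerivWithin_fun_const_smul_field, norm_smul, Real.norm_eq_abs]
    exact mul_le_mul_of_nonneg_left (hg.bound j hj x hx) (abs_nonneg c)⟩

theorem sub (hg : CkBound n B g) (hh : CkBound n C h) : CkBound n (B + C) (fun x => g x - h x) := by
  have := hg.add (hh.const_smul (-1))
  simpa [sub_eq_add_neg] using this

theorem clm_comp {F : Type*} [NormedAddCommGroup F] [NormedSpace ℝ F] (L : E →L[ℝ] F)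
    (hg : CkBound n B g) : CkBound n (‖L‖ * B) (fun x => L (g x)) :=
  ⟨L.contDiff.comp_contDiffOn hg.smooth, fun j hj x hx => by
    rw [iteratedDerivWithin_clm_comp L (hg.smooth.of_le (by exact_mod_cast hj)) uniqueDiffOn_ref hx]
    exact (L.le_opNorm _).trans (mul_le_mul_of_nonneg_left (hg.bound j hj x hx) (norm_nonneg _))⟩

theorem zero_order (hg : ContinuousOn g (Icc (-1) 1)) (hB : ∀ x ∈ Icc (-1 : ℝ) 1, ‖g x‖ ≤ B) :
    CkBound 0 B g :=
  ⟨contDiffOn_zero.2 hg, fun j hj x hx => by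
    obtain rfl : j = 0 := by omega
    simpa using hB x hx⟩

/-- A function is bounded in `C^(n+1)` if it is bounded and its derivative is bounded in `C^n`. -/
theorem succ (hd : ∀ x ∈ Icc (-1 : ℝ) 1, HasDerivWithinAt g (h x) (Icc (-1) 1) x)
    (hB : ∀ x ∈ Icc (-1 : ℝ) 1, ‖g x‖ ≤ B) (hh : CkBound n B h) : CkBound (n + 1) B g := by
  have hderiv : EqOn (derivWithin g (Icc (-1) 1)) h (Icc (-1) 1) := fun x hx =>
    (hd x hx).derivWithin (uniqueDiffOn_ref x hx)
  refine ⟨?_, fun j hj x hx => ?_⟩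
  · push_cast
    rw [contDiffOn_succ_iff_derivWithin uniqueDiffOn_ref]
    refine ⟨fun x hx => (hd x hx).differentiableWithinAt, by simp, hh.smooth.congr hderiv⟩
  · rcases j with _ | j
    · simpa using hB x hx
    · rw [iteratedDerivWithin_succ', iteratedDerivWithin_congr hderiv hx]
      exact hh.bound j (by omega) x hx

theorem derivWithin (hg : CkBound (n + 1) B g) :
    CkBound n B (_root_.derivWithin g (Icc (-1) 1)) := by
  have hs := hg.smooth
  push_cast at hs
  rw [contDiffOn_succ_iff_derivWithin uniqueDiffOn_ref] at hs
  exact ⟨hs.2.2, fun j hj x hx => by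
    rw [← iteratedDerivWithin_succ']; exact hg.bound (j + 1) (by omega) x hx⟩

theorem hasDerivWithinAt (hg : CkBound (n + 1) B g) {x : ℝ} (hx : x ∈ Icc (-1 : ℝ) 1) :
    HasDerivWithinAt g (_root_.derivWithin g (Icc (-1) 1) x) (Icc (-1) 1) x :=
  ((hg.smooth.differentiableOn (by simp)) x hx).hasDerivWithinAt

/-- The factor `2 ^ n` comes from the product rule: each differentiation splits a product into two,
with one order less to control. -/
theorem mul {g h : ℝ → ℝ} (hg : CkBound n B g) (hh : CkBound n C h) :
    CkBound n (2 ^ n * (B * C)) (fun x => g x * h x) := by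
  induction n generalizing g h with
  | zero =>
    refine zero_order (hg.smooth.continuousOn.mul hh.smooth.continuousOn) fun x hx => ?_
    rw [norm_mul, pow_zero, one_mul]
    exact mul_le_mul (hg.norm_le hx) (hh.norm_le hx) (norm_nonneg _) hg.nonneg
  | succ n ih =>
    have hBC := mul_nonneg hg.nonneg hh.nonneg
    refine succ (fun x hx => (hg.hasDerivWithinAt hx).mul (hh.hasDerivWithinAt hx))
      (fun x hx => ?_) ?_
    · rw [norm_mul]
      refine (mul_le_mul (hg.norm_le hx) (hh.norm_le hx) (norm_nonneg _) hg.nonneg).trans ?_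
      exact le_mul_of_one_le_left hBC (one_le_pow₀ (by norm_num))
    · refine ((ih hg.derivWithin (hh.of_le (Nat.le_succ n))).add
        (ih (hg.of_le (Nat.le_succ n)) hh.derivWithin)).weaken (le_of_eq (by ring))

/-- A bound for the initial value and for the derivatives implies a bound in `C^(n+1)`. -/
theorem integrate {A : ℝ} (hd : ∀ x ∈ Icc (-1 : ℝ) 1, HasDerivWithinAt g (h x) (Icc (-1) 1) x)
    (hh : CkBound n B h) (hA : ‖g (-1)‖ ≤ A) : CkBound (n + 1) (A + 2 * B) g := by
  have hB := hh.nonneg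
  have hA' := (norm_nonneg _).trans hA
  refine succ hd (fun x hx => ?_) (hh.weaken (by linarith))
  have := (convex_Icc (-1 : ℝ) 1).norm_image_sub_le_of_norm_hasDerivWithin_le hd
    (fun y hy => hh.norm_le hy) (left_mem_Icc.2 (by norm_num)) hx
  have h1 : ‖x - -1‖ ≤ 2 := by
    rw [Real.norm_eq_abs, abs_le]; constructor <;> linarith [hx.1, hx.2]
  calc ‖g x‖ ≤ ‖g (-1)‖ + ‖g x - g (-1)‖ := norm_le_norm_add_norm_sub' _ _
    _ ≤ A + B * ‖x - -1‖ := add_le_add hA this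
    _ ≤ A + 2 * B := by nlinarith

theorem apply {d : ℕ} {φ : ℝ → Vec d} (hφ : CkBound n B φ) (i : Fin d) :
    CkBound n B (fun x => φ x i) := by
  refine ⟨?_, fun j hj x hx => ?_⟩
  · exact (hφ.clm_comp (EuclideanSpace.proj i : Vec d →L[ℝ] ℝ)).smooth
  · have := iteratedDerivWithin_clm_comp (EuclideanSpace.proj i : Vec d →L[ℝ] ℝ)
      (hφ.smooth.of_le (by exact_mod_cast hj)) uniqueDiffOn_ref hx
    change iteratedDerivWithin j (fun x => φ x i) _ x = _ at this
    rw [this]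
    exact (PiLp.norm_apply_le _ i).trans (hφ.bound j hj x hx)

/-- Functions of class `C^n` on `[-1,1]` are bounded in `C^n`. -/
theorem exists_of_contDiffOn (hg : ContDiffOn ℝ n g (Icc (-1) 1)) : ∃ B, CkBound n B g := by
  have h1 : ∀ j ∈ Finset.range (n + 1), ∃ B : ℝ, ∀ x ∈ Icc (-1 : ℝ) 1,
      ‖iteratedDerivWithin j g (Icc (-1) 1) x‖ ≤ B := fun j hj =>
    isCompact_Icc.exists_bound_of_continuousOn (hg.continuousOn_iteratedDerivWithin
      (by exact_mod_cast Nat.lt_succ_iff.1 (Finset.mem_range.1 hj)) uniqueDiffOn_ref)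
  choose! b hb using h1
  refine ⟨∑ j ∈ Finset.range (n + 1), |b j|, hg, fun j hj x hx => ?_⟩
  have hj' : j ∈ Finset.range (n + 1) := Finset.mem_range.2 (by omega)
  exact ((hb j hj' x hx).trans (le_abs_self _)).trans
    (Finset.single_le_sum (f := fun j => |b j|) (fun _ _ => abs_nonneg _) hj')

theorem supOn_le (hg : CkBound n B g) {j : ℕ} (hj : j ≤ n) :
    supOn (Icc (-1) 1) (iteratedDerivWithin j g (Icc (-1) 1)) ≤ B := by
  refine csSup_le ((nonempty_Icc.2 (by norm_num)).image _) ?_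
  rintro _ ⟨x, hx, rfl⟩
  exact hg.bound j hj x hx

theorem sum_supOn_le (hg : CkBound n B g) :
    ∑ j ∈ Finset.range (n + 1), supOn (Icc (-1) 1) (iteratedDerivWithin j g (Icc (-1) 1))
      ≤ (n + 1) * B := by
  refine (Finset.sum_le_card_nsmul _ _ B fun j hj =>
    hg.supOn_le (Nat.lt_succ_iff.1 (Finset.mem_range.1 hj))).trans (le_of_eq ?_)
  simp

end CkBound

theorem supOn_nonneg {E : Type*} [NormedAddCommGroup E] (S : Set ℝ) (g : ℝ → E) : 0 ≤ supOn S g :=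
  Real.sSup_nonneg (by rintro _ ⟨x, -, rfl⟩; exact norm_nonneg _)

theorem le_supOn {E : Type*} [NormedAddCommGroup E] {S : Set ℝ} (hS : IsCompact S) {g : ℝ → E}
    (hg : ContinuousOn g S) {x : ℝ} (hx : x ∈ S) : ‖g x‖ ≤ supOn S g :=
  le_csSup (hS.image_of_continuousOn hg.norm).bddAbove ⟨x, hx, rfl⟩

/-! ### Polynomials -/

theorem contDiff_eval {n : WithTop ℕ∞} (p : ℝ[X]) : ContDiff ℝ n (fun x => p.eval x) := by
  simpa using p.contDiff_aeval (𝕜 := ℝ) n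

theorem contDiffOn_eval (n : ℕ) (p : ℝ[X]) (s : Set ℝ) : ContDiffOn ℝ n (fun x => p.eval x) s :=
  (contDiff_eval p).contDiffOn

theorem iteratedDeriv_eval (j : ℕ) (p : ℝ[X]) :
    iteratedDeriv j (fun x => p.eval x) = fun x => (derivative^[j] p).eval x := by
  induction j with
  | zero => simp
  | succ j ih =>
    rw [iteratedDeriv_succ, ih, Function.iterate_succ_apply']
    ext x
    exact (derivative^[j] p).deriv

theorem iteratedDerivWithin_eval (j : ℕ) (p : ℝ[X]) {s : Set ℝ} (hs : UniqueDiffOn ℝ s) {x : ℝ}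
    (hx : x ∈ s) : iteratedDerivWithin j (fun x => p.eval x) s x = (derivative^[j] p).eval x := by
  rw [iteratedDerivWithin_eq_iteratedDeriv hs (contDiff_eval p).contDiffAt hx, iteratedDeriv_eval]

/-- Every polynomial of degree less than `m` is the derivative of one of degree at most `m`. -/
theorem exists_derivative_eq {m : ℕ} {q : ℝ[X]} (hq : q ∈ degreeLT ℝ m) (c : ℝ) :
    ∃ p ∈ degreeLT ℝ (m + 1), derivative p = q ∧ p.eval (-1) = c := by
  set s : ℝ[X] := ∑ j ∈ Finset.range m, monomial (j + 1) (q.coeff j / (j + 1)) with hs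
  have hsm : s ∈ degreeLT ℝ (m + 1) := by
    refine Submodule.sum_mem _ fun j hj => ?_
    rw [mem_degreeLT]
    refine (degree_monomial_le _ _).trans_lt ?_
    have := Finset.mem_range.1 hj
    exact_mod_cast Nat.succ_lt_succ this
  refine ⟨s + C (c - s.eval (-1)), Submodule.add_mem _ hsm ?_, ?_, by simp⟩
  · rw [mem_degreeLT]
    exact degree_C_le.trans_lt (by exact_mod_cast Nat.succ_pos m)
  · ext j
    simp only [hs, derivative_add, derivative_C, add_zero, derivative_sum, derivative_monomial,
      finsetSum_coeff, coeff_monomial, Nat.add_sub_cancel]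
    by_cases hj : j < m
    · rw [Finset.sum_eq_single j]
      · have : (j : ℝ) + 1 ≠ 0 := by positivity
        simp; field_simp
      · intro i _ hi; simp [hi]
      · intro h; exact absurd (Finset.mem_range.2 hj) h
    · rw [Finset.sum_eq_zero]
      · exact (coeff_eq_zero_of_degree_lt ((mem_degreeLT.1 hq).trans_le
          (by exact_mod_cast not_lt.1 hj))).symm
      · intro i hi
        have := Finset.mem_range.1 hi
        rw [if_neg (by omega)]

/-- Taylor approximation in `C^n([-1,1])` by polynomials of degree less than `m`. -/
theorem exists_taylor_approx {n m : ℕ} {B : ℝ} {g : ℝ → ℝ}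
    (hg : ContDiffOn ℝ (max n m : ℕ) g (Icc (-1) 1))
    (hB : ∀ j, m ≤ j → j ≤ max n m → ∀ x ∈ Icc (-1 : ℝ) 1,
      |iteratedDerivWithin j g (Icc (-1) 1) x| ≤ B) :
    ∃ q ∈ degreeLT ℝ m, CkBound n (2 ^ m * B) (fun x => g x - q.eval x) := by
  -- At order `max n m` the claim for `(n, m + 1)` follows from a claim one order lower for the
  -- derivative; the order `n` alone would not drop when `n = 0`.
  suffices H : ∃ q ∈ degreeLT ℝ m, CkBound (max n m) (2 ^ m * B) (fun x => g x - q.eval x) by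
    obtain ⟨q, hq, h⟩ := H
    exact ⟨q, hq, h.of_le (le_max_left _ _)⟩
  induction m generalizing n g with
  | zero =>
    refine ⟨0, Submodule.zero_mem _, ?_⟩
    simpa using (⟨hg, fun j hj => hB j (Nat.zero_le _) hj⟩ : CkBound (max n 0) B g)
  | succ m ih =>
    obtain ⟨n', hn'⟩ : ∃ n', max n (m + 1) = max n' m + 1 := ⟨n - 1, by omega⟩
    rw [hn'] at hg hB ⊢
    have hs := hg
    push_cast at hs
    rw [contDiffOn_succ_iff_derivWithin uniqueDiffOn_ref] at hs
    obtain ⟨q, hq, hgq⟩ := ih (n := n') (g := derivWithin g (Icc (-1) 1)) (by exact_mod_cast hs.2.2)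
      (fun j hj hj' x hx => by
        rw [← iteratedDerivWithin_succ']; exact hB (j + 1) (by omega) (by omega) x hx)
    -- The approximation of `g'` is integrated from the exact value at `-1`. The error vanishes
    -- there, so each integration costs only the length `2` of the interval, which gives `2 ^ m`.
    obtain ⟨p, hp, hpq, hp1⟩ := exists_derivative_eq hq (g (-1))
    refine ⟨p, hp, ?_⟩
    refine (CkBound.integrate (A := 0) (fun x hx => ?_) hgq ?_).weaken (le_of_eq (by ring))
    · refine ((hs.1 x hx).hasDerivWithinAt).sub ?_
      rw [← hpq]
      exact p.hasDerivWithinAt x _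
    · simp [hp1]

/-- The sum of the absolute values of the first `r` coefficients. -/
noncomputable def coeffNorm (r : ℕ) (p : ℝ[X]) : ℝ := ∑ j ∈ Finset.range r, |p.coeff j|

theorem coeffNorm_nonneg (r : ℕ) (p : ℝ[X]) : 0 ≤ coeffNorm r p :=
  Finset.sum_nonneg fun _ _ => abs_nonneg _

theorem eval_eq_sum_of_mem_degreeLT {r : ℕ} {p : ℝ[X]} (hp : p ∈ degreeLT ℝ r) (x : ℝ) :
    p.eval x = ∑ j ∈ Finset.range r, p.coeff j * x ^ j := by
  rcases eq_or_ne p 0 with rfl | h0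
  · simp
  · exact eval_eq_sum_range' ((natDegree_lt_iff_degree_lt h0).2 (mem_degreeLT.1 hp)) x

theorem CkBound.sum {ι E : Type*} [NormedAddCommGroup E] [NormedSpace ℝ E] (s : Finset ι) {n : ℕ}
    {B : ι → ℝ} {g : ι → ℝ → E} (h : ∀ i ∈ s, CkBound n (B i) (g i)) :
    CkBound n (∑ i ∈ s, B i) (fun x => ∑ i ∈ s, g i x) := by
  classical
  induction s using Finset.induction_on with
  | empty =>
    refine ⟨by simpa using contDiffOn_const, fun j _ x _ => ?_⟩
    simp [iteratedDerivWithin_fun_const_zero]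
  | insert i s hi ih =>
    simp only [Finset.sum_insert hi]
    exact (h i (Finset.mem_insert_self _ _)).add
      (ih fun j hj => h j (Finset.mem_insert_of_mem hj))

/-- One half of the equivalence of norms on polynomials of bounded degree: control of finitely many
numbers controls all derivatives. It replaces inverse inequalities. -/
theorem exists_ckBound_eval (n r : ℕ) :
    ∃ C, 0 ≤ C ∧ ∀ p ∈ degreeLT ℝ r, CkBound n (C * coeffNorm r p) (fun x => p.eval x) := by
  have h1 : ∀ j : ℕ, ∃ B, CkBound n B (fun x : ℝ => x ^ j) := fun j =>
    CkBound.exists_of_contDiffOn (contDiff_id.pow j).contDiffOn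
  choose B hB using h1
  have hB0 : ∀ j, 0 ≤ B j := fun j => (hB j).nonneg
  refine ⟨∑ j ∈ Finset.range r, B j, Finset.sum_nonneg fun j _ => hB0 j, fun p hp => ?_⟩
  have h2 := CkBound.sum (Finset.range r) (fun j _ => (hB j).const_smul (p.coeff j))
  refine (h2.congr fun x _ => ?_).weaken ?_
  · simpa using eval_eq_sum_of_mem_degreeLT hp x
  · rw [coeffNorm, Finset.mul_sum]
    refine Finset.sum_le_sum fun j hj => ?_
    rw [mul_comm]
    exact mul_le_mul_of_nonneg_right
      (Finset.single_le_sum (f := B) (fun i _ => hB0 i) hj) (abs_nonneg _)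

/-! ### Bounds for the operators on scalar functions -/

/-- A scalar function is placed in the coordinate `i₀` of an `ℝ^d`-valued one, to which the
assumption applies. This needs a coordinate, that is `d > 0`. -/
theorem AssSupIntegrator.exists_bound {d kI : ℕ} {Q : (ℝ → ℝ) → ℝ} (hSup : AssSupIntegrator d kI Q)
    (i₀ : Fin d) :
    ∃ C, 0 ≤ C ∧ ∀ (B : ℝ) (φ : ℝ → ℝ), CkBound kI B φ → |Q φ| ≤ C * B := by
  obtain ⟨C₀, hC₀⟩ := hSup
  set v : Vec d := EuclideanSpace.single i₀ 1 with hv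
  set L : ℝ →L[ℝ] Vec d := ContinuousLinearMap.toSpanSingleton ℝ v with hL
  refine ⟨|C₀| * ((kI + 1) * ‖L‖), by positivity, fun B φ hφ => ?_⟩
  have hΦ := hφ.clm_comp L
  have h1 := hC₀ _ hΦ.smooth
  have h2 : vecInt Q (fun x => L (φ x)) i₀ = Q φ := by
    simp [vecInt, hL, hv]
  rw [← h2, ← Real.norm_eq_abs]
  refine ((PiLp.norm_apply_le _ i₀).trans h1).trans ?_
  refine (mul_le_mul_of_nonneg_right (le_abs_self C₀)
    (Finset.sum_nonneg fun _ _ => supOn_nonneg _ _)).trans ?_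
  rw [mul_assoc, mul_assoc]
  exact mul_le_mul_of_nonneg_left hΦ.sum_supOn_le (abs_nonneg _)

theorem IsRefApproximation.exists_bound {d kI kA : ℕ} {A : (ℝ → ℝ) → ℝ → ℝ}
    (hA : IsRefApproximation kA A) (hSup : AssSupApprox d kI kA A) (i₀ : Fin d) :
    ∃ C, 0 ≤ C ∧ ∀ (B : ℝ) (φ : ℝ → ℝ), CkBound (max kA kI) B φ → CkBound kI (C * B) (A φ) := by
  obtain ⟨C₁, hC₁⟩ := hSup
  set v : Vec d := EuclideanSpace.single i₀ 1 with hv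
  set L : ℝ →L[ℝ] Vec d := ContinuousLinearMap.toSpanSingleton ℝ v with hL
  refine ⟨|C₁| * ((max kA kI + 1) * ‖L‖), by positivity, fun B φ hφ => ?_⟩
  have hcomp : ∀ i, ContDiffOn ℝ (max kA kI : ℕ) (fun x => L (φ x) i) (Icc (-1) 1) := fun i =>
    ((hφ.clm_comp L).apply i).smooth
  have hvec : ContDiffOn ℝ kI (vecApprox A fun x => L (φ x)) (Icc (-1) 1) :=
    contDiffOn_piLp' _ fun i => hA.smooth kI _ (hcomp i)
  have hvi : (fun x => vecApprox A (fun x => L (φ x)) x i₀) = A φ := by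
    funext x; simp [vecApprox, hL, hv]
  refine ⟨hA.smooth kI φ hφ.smooth, fun l hl x hx => ?_⟩
  have hΦ := (hφ.clm_comp L).of_le (max_le_max_left kA hl)
  have h1 := hC₁ l hl _ hΦ.smooth
  have hvl : ContDiffOn ℝ l (vecApprox A fun x => L (φ x)) (Icc (-1) 1) :=
    hvec.of_le (by exact_mod_cast hl)
  -- A real `sSup` bounds the values only if they are bounded above; this is where the smoothness of
  -- the values of `A` is needed.
  have h2 := le_supOn isCompact_Icc
    (hvec.continuousOn_iteratedDerivWithin (m := l) (by exact_mod_cast hl) uniqueDiffOn_ref) hx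
  have h3 := iteratedDerivWithin_clm_comp (EuclideanSpace.proj i₀ : Vec d →L[ℝ] ℝ) hvl
    uniqueDiffOn_ref hx
  change iteratedDerivWithin l (fun x => vecApprox A (fun x => L (φ x)) x i₀) _ x = _ at h3
  rw [hvi] at h3
  rw [h3]
  refine ((PiLp.norm_apply_le _ i₀).trans h2).trans (h1.trans ?_)
  refine (mul_le_mul_of_nonneg_right (le_abs_self C₁)
    (Finset.sum_nonneg fun _ _ => supOn_nonneg _ _)).trans ?_
  rw [mul_assoc, mul_assoc]
  refine mul_le_mul_of_nonneg_left (hΦ.sum_supOn_le.trans ?_) (abs_nonneg _)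
  have hle : ((max kA l : ℕ) : ℝ) ≤ ((max kA kI : ℕ) : ℝ) := by
    exact_mod_cast max_le_max_left kA hl
  push_cast at hle ⊢
  have := hΦ.nonneg
  nlinarith

/-! ### Stability of the discrete equations on the reference interval -/

/-- The integrator as a linear functional on polynomials. -/
noncomputable def polyInt {kI : ℕ} {Q : (ℝ → ℝ) → ℝ} (hQ : IsRefIntegrator kI Q) : ℝ[X] →ₗ[ℝ] ℝ where
  toFun p := Q (fun x => p.eval x)
  map_add' p q := by
    simp only [eval_add]
    exact hQ.add _ _ (contDiffOn_eval _ _ _) (contDiffOn_eval _ _ _)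
  map_smul' c p := by
    simp only [eval_smul, smul_eq_mul]
    exact hQ.smul c _ (contDiffOn_eval _ _ _)

theorem polyInt_apply {kI : ℕ} {Q : (ℝ → ℝ) → ℝ} (hQ : IsRefIntegrator kI Q) (p : ℝ[X]) :
    polyInt hQ p = Q (fun x => p.eval x) := rfl

/-- Functionals without a common zero other than `0` span the dual space, so every coefficient is a
fixed linear combination of them. -/
theorem exists_coeffNorm_le {ι : Type*} [Fintype ι] {r : ℕ} (ℓ : ι → degreeLT ℝ r →ₗ[ℝ] ℝ)
    (hℓ : ∀ p, (∀ s, ℓ s p = 0) → p = 0) :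
    ∃ C, 0 ≤ C ∧ ∀ (p : degreeLT ℝ r) (B : ℝ), (∀ s, |ℓ s p| ≤ B) →
      coeffNorm r (p : ℝ[X]) ≤ C * B := by
  have h1 : ∀ j : ℕ, ∃ c : ι → ℝ, ∀ p : degreeLT ℝ r, (p : ℝ[X]).coeff j = ∑ s, c s * ℓ s p := by
    intro j
    have h2 : (lcoeff ℝ j).comp (degreeLT ℝ r).subtype ∈ Submodule.span ℝ (range ℓ) := by
      refine mem_span_of_iInf_ker_le_ker fun p hp => ?_
      have : p = 0 := hℓ p fun s => by
        have := (Submodule.mem_iInf _).1 hp s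
        exact this
      rw [this]; exact Submodule.zero_mem _
    obtain ⟨c, hc⟩ := (Submodule.mem_span_range_iff_exists_fun ℝ).1 h2
    refine ⟨c, fun p => ?_⟩
    have := LinearMap.congr_fun hc p
    simpa using this.symm
  choose c hc using h1
  refine ⟨∑ j ∈ Finset.range r, ∑ s, |c j s|, by positivity, fun p B hB => ?_⟩
  rw [coeffNorm, Finset.sum_mul]
  refine Finset.sum_le_sum fun j _ => ?_
  rw [hc, Finset.sum_mul]
  refine (Finset.abs_sum_le_sum_abs _ _).trans (Finset.sum_le_sum fun s _ => ?_)
  rw [abs_mul]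
  exact mul_le_mul_of_nonneg_left (hB s) (abs_nonneg _)

/-- A polynomial with zeros at `1` and `-1` of the orders `m` and `n`. -/
theorem exists_eq_weight_mul {m n : ℕ} {p : ℝ[X]} (h1 : ∀ i < m, (derivative^[i] p).eval 1 = 0)
    (h2 : ∀ i < n, (derivative^[i] p).eval (-1) = 0) :
    ∃ q, p = (1 - X) ^ m * (1 + X) ^ n * q := by
  rcases eq_or_ne p 0 with rfl | h0
  · exact ⟨0, by simp⟩
  have key : ∀ (l : ℕ) (t : ℝ), (∀ i < l, (derivative^[i] p).eval t = 0) → (X - C t) ^ l ∣ p := by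
    intro l t h
    refine (le_rootMultiplicity_iff h0).1 ?_
    rcases l with _ | l
    · exact Nat.zero_le _
    · exact lt_rootMultiplicity_of_isRoot_iterate_derivative h0 fun i hi => h i (by omega)
  have hcop : IsCoprime ((X - C (1 : ℝ)) ^ m) ((X - C (-1 : ℝ)) ^ n) :=
    (isCoprime_X_sub_C_of_isUnit_sub (by norm_num)).pow
  obtain ⟨q, hq⟩ := hcop.mul_dvd (key m 1 h1) (key n (-1) h2)
  refine ⟨(-1) ^ m * q, ?_⟩
  have e1 : (1 - X : ℝ[X]) = (-1) * (X - C 1) := by simp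
  have e2 : (1 + X : ℝ[X]) = X - C (-1) := by simp; ring
  have e3 : ((-1 : ℝ[X]) ^ m) * (-1) ^ m = 1 := by rw [← mul_pow]; simp
  rw [e1, e2, mul_pow, hq]
  linear_combination (-((X - C 1) ^ m * (X - C (-1)) ^ n * q)) * e3

/-- The test polynomials; they vanish at `-1` if `k = 0`. -/
noncomputable def testPoly (k j : ℕ) : ℝ[X] := (1 + X) ^ (if k = 0 then 1 else 0) * X ^ j

theorem testPoly_mem {r k j : ℕ} (hkr : k ≤ r) (hj : j < r + 1 - max 1 k) :
    testPoly k j ∈ degreeLT ℝ (r - k + 1) := by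
  have h1 : (1 + X : ℝ[X]).natDegree ≤ 1 := by
    refine (natDegree_add_le _ _).trans ?_
    simp
  refine mem_degreeLT.2 ((degree_le_natDegree).trans_lt ?_)
  have h2 : (testPoly k j).natDegree ≤ (if k = 0 then 1 else 0) + j := by
    refine natDegree_mul_le.trans (add_le_add ?_ (natDegree_X_pow_le j))
    refine natDegree_pow_le.trans ?_
    exact (Nat.mul_le_mul_left _ h1).trans (by simp)
  have h3 : (testPoly k j).natDegree < r - k + 1 := by
    split_ifs at h2 <;> omega
  exact_mod_cast h3

/-- The homogeneous boundary conditions split off the factor `(1-X)^⌊k/2⌋ (1+X)^⌊(k-1)/2⌋`, and the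
cofactor is the `ψ` of the unisolvence assumption. For `k = 0` the exponent `|⌊-1/2⌋| = 1` of `1 +
x` is supplied by `testPoly` instead. -/
theorem AssIntegrator.eq_zero {r k kI : ℕ} (hkr : k ≤ r) {Q : (ℝ → ℝ) → ℝ}
    (hQ : IsRefIntegrator kI Q) (hInt : AssIntegrator r k Q) {p : ℝ[X]} (hp : p ∈ degreeLT ℝ r)
    (h1 : ∀ i < k / 2, (derivative^[i] p).eval 1 = 0)
    (h2 : ∀ i < (k - 1) / 2, (derivative^[i] p).eval (-1) = 0)
    (h3 : ∀ j < r + 1 - max 1 k, polyInt hQ (p * testPoly k j) = 0) : p = 0 := by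
  obtain ⟨q, hq⟩ := exists_eq_weight_mul h1 h2
  by_contra hp0
  have hq0 : q ≠ 0 := fun h => hp0 (by rw [hq, h, mul_zero])
  have hm1 : ((1 - X : ℝ[X]) ^ (k / 2)).natDegree = k / 2 := by
    rw [natDegree_pow, show (1 - X : ℝ[X]) = -(X - C 1) by simp, natDegree_neg, natDegree_X_sub_C,
      mul_one]
  have hm2 : ((1 + X : ℝ[X]) ^ ((k - 1) / 2)).natDegree = (k - 1) / 2 := by
    rw [natDegree_pow, show (1 + X : ℝ[X]) = X + C 1 by simp [add_comm], natDegree_X_add_C, mul_one]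
  have hW : (1 - X : ℝ[X]) ^ (k / 2) * (1 + X) ^ ((k - 1) / 2) ≠ 0 :=
    fun h => hp0 (by rw [hq, h, zero_mul])
  have hdeg : p.natDegree = k / 2 + (k - 1) / 2 + q.natDegree := by
    rw [hq, natDegree_mul hW hq0, natDegree_mul (left_ne_zero_of_mul hW) (right_ne_zero_of_mul hW),
      hm1, hm2]
  have hpr : p.natDegree < r := (natDegree_lt_iff_degree_lt hp0).2 (mem_degreeLT.1 hp)
  -- The degrees match because `k / 2 + (k - 1) / 2 = max 1 k - 1`, also for `k = 0` with truncated
  -- subtraction.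
  have hqm : q ∈ degreeLT ℝ (r + 1 - max 1 k) :=
    mem_degreeLT.2 ((natDegree_lt_iff_degree_lt hq0).1 (by omega))
  refine hq0 (hInt q hqm fun φ hφ => ?_)
  set W : ℝ[X] := p * (1 + X) ^ (if k = 0 then 1 else 0) with hWdef
  have hker : degreeLT ℝ (r + 1 - max 1 k) ≤
      LinearMap.ker ((polyInt hQ).comp (LinearMap.mulLeft ℝ W)) := by
    classical
    rw [degreeLT_eq_span_X_pow, Submodule.span_le]
    intro s hs
    obtain ⟨j, hj, rfl⟩ : ∃ j < r + 1 - max 1 k, (X : ℝ[X]) ^ j = s := by simpa using hs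
    have := h3 j hj
    rw [testPoly, ← mul_assoc] at this
    simpa [hWdef] using this
  have := hker hφ
  simp only [LinearMap.mem_ker, LinearMap.comp_apply, LinearMap.mulLeft_apply, polyInt_apply] at this
  convert this using 2
  funext x
  rw [hWdef, hq]
  rcases Nat.eq_zero_or_pos k with rfl | hk
  · simp [mul_comm (1 + x)]
  · simp [hk.ne']

/-- The polynomials of degree less than `r` that satisfy the discrete equations on `[-1,1]` with
right-hand side `g` are bounded by `g`. -/
theorem exists_stability {r k kI kA K : ℕ} (hkr : k ≤ r) {Q : (ℝ → ℝ) → ℝ}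
    (hQ : IsRefIntegrator kI Q) {A : (ℝ → ℝ) → ℝ → ℝ} (hInt : AssIntegrator r k Q) {CQ CA : ℝ}
    (hCQ0 : 0 ≤ CQ) (hCQ : ∀ (B : ℝ) (φ : ℝ → ℝ), CkBound kI B φ → |Q φ| ≤ CQ * B)
    (hCA0 : 0 ≤ CA)
    (hCA : ∀ (B : ℝ) (φ : ℝ → ℝ), CkBound (max kA kI) B φ → CkBound kI (CA * B) (A φ))
    (hK : max kA kI ≤ K) (hkK : k / 2 - 1 ≤ K) :
    ∃ C, 0 ≤ C ∧ ∀ R ∈ degreeLT ℝ r, ∀ (g : ℝ → ℝ) (B : ℝ), CkBound K B g →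
      (∀ i < k / 2, (derivative^[i] R).eval 1 = iteratedDerivWithin i g (Icc (-1) 1) 1) →
      (∀ i < (k - 1) / 2, (derivative^[i] R).eval (-1) = iteratedDerivWithin i g (Icc (-1) 1) (-1)) →
      (∀ ψ ∈ degreeLT ℝ (r - k + 1), (k = 0 → ψ.eval (-1) = 0) →
        Q (fun x => R.eval x * ψ.eval x) = Q (fun x => A g x * ψ.eval x)) →
      coeffNorm r R ≤ C * B := by
  set ν := r + 1 - max 1 k with hν
  -- The left-hand sides of the discrete equations: derivatives at `1`, derivatives at `-1`, and
  -- moments against the test polynomials. Their number is `r`, the dimension of the space.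
  let ℓ : (Fin (k / 2) ⊕ Fin ((k - 1) / 2)) ⊕ Fin ν → degreeLT ℝ r →ₗ[ℝ] ℝ :=
    Sum.elim (Sum.elim
      (fun i => (leval 1).comp ((derivative ^ (i : ℕ)).comp (degreeLT ℝ r).subtype))
      (fun i => (leval (-1)).comp ((derivative ^ (i : ℕ)).comp (degreeLT ℝ r).subtype)))
      (fun j => ((polyInt hQ).comp (LinearMap.mulRight ℝ (testPoly k j))).comp
        (degreeLT ℝ r).subtype)
  obtain ⟨C, hC0, hC⟩ := exists_coeffNorm_le ℓ fun p hp => by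
    refine Subtype.ext (hInt.eq_zero hkr hQ p.2 (fun i hi => ?_) (fun i hi => ?_) fun j hj => ?_)
    · simpa [ℓ, Module.End.pow_apply, leval] using hp (Sum.inl (Sum.inl ⟨i, hi⟩))
    · simpa [ℓ, Module.End.pow_apply, leval] using hp (Sum.inl (Sum.inr ⟨i, hi⟩))
    · simpa [ℓ] using hp (Sum.inr ⟨j, hj⟩)
  have hT : ∀ j : ℕ, ∃ B, CkBound kI B (fun x => (testPoly k j).eval x) := fun j =>
    CkBound.exists_of_contDiffOn (contDiffOn_eval _ _ _)
  choose b hb using hT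
  have hb0 : ∀ j, 0 ≤ b j := fun j => (hb j).nonneg
  -- The summand `1` serves the boundary functionals, the sum serves the moments.
  set D : ℝ := 1 + ∑ j ∈ Finset.range ν, CQ * (2 ^ kI * (CA * b j)) with hD
  have hsum0 : ∀ j, 0 ≤ CQ * (2 ^ kI * (CA * b j)) := fun j => by have := hb0 j; positivity
  have hD1 : 1 ≤ D := le_add_of_nonneg_right (Finset.sum_nonneg fun j _ => hsum0 j)
  refine ⟨C * D, mul_nonneg hC0 (by linarith), fun R hR g B hg h1 h2 h3 => ?_⟩
  have hB0 := hg.nonneg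
  rw [mul_assoc]
  refine hC ⟨R, hR⟩ (D * B) ?_
  have hBD : B ≤ D * B := le_mul_of_one_le_left hB0 hD1
  rintro ((i | i) | j)
  · have := h1 i i.2
    have h := hg.bound i (by omega) 1 (by simp)
    rw [Real.norm_eq_abs, ← this] at h
    simpa [ℓ, Module.End.pow_apply, leval] using h.trans hBD
  · have := h2 i i.2
    have h := hg.bound i (by omega) (-1) (by simp)
    rw [Real.norm_eq_abs, ← this] at h
    simpa [ℓ, Module.End.pow_apply, leval] using h.trans hBD
  -- For `k = 0` the factor `1 + X` makes the test polynomial vanish at `-1`, as the hypothesis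
  -- demands.
  · have h := h3 (testPoly k j) (testPoly_mem hkr (by omega)) (fun hk => by simp [testPoly, hk])
    have hq := hCQ _ _ ((hCA B g (hg.of_le hK)).mul (hb j))
    rw [← h] at hq
    have e : ℓ (Sum.inr j) ⟨R, hR⟩ = Q (fun x => R.eval x * (testPoly k j).eval x) := by
      simp [ℓ, polyInt_apply]
    rw [e]
    refine hq.trans ?_
    rw [show CQ * (2 ^ kI * (CA * B * b j)) = CQ * (2 ^ kI * (CA * b j)) * B by ring]
    refine mul_le_mul_of_nonneg_right ?_ hB0
    have := Finset.single_le_sum (f := fun j => CQ * (2 ^ kI * (CA * b j))) (fun i _ => hsum0 i)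
      (Finset.mem_range.2 (show (j : ℕ) < ν by omega))
    linarith

/-! ### Transformation to the reference interval -/

theorem affineMap_neg_one (a b : ℝ) : affineMap a b (-1) = a := by unfold affineMap; ring

theorem affineMap_one (a b : ℝ) : affineMap a b 1 = b := by unfold affineMap; ring

theorem affineInv_affineMap {a b : ℝ} (hab : a < b) (x : ℝ) :
    affineInv a b (affineMap a b x) = x := by
  have : b - a ≠ 0 := by linarith
  unfold affineMap affineInv
  field_simp; ring

theorem affineMap_affineInv {a b : ℝ} (hab : a < b) (t : ℝ) :
    affineMap a b (affineInv a b t) = t := by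
  have : b - a ≠ 0 := by linarith
  unfold affineMap affineInv
  field_simp; ring

theorem affineMap_mem {a b : ℝ} (hab : a < b) {x : ℝ} (hx : x ∈ Icc (-1 : ℝ) 1) :
    affineMap a b x ∈ Icc a b := by
  unfold affineMap
  constructor <;> nlinarith [hx.1, hx.2]

theorem affineInv_mem {a b : ℝ} (hab : a < b) {t : ℝ} (ht : t ∈ Icc a b) :
    affineInv a b t ∈ Icc (-1 : ℝ) 1 := by
  unfold affineInv
  have h : 0 < b - a := by linarith
  constructor
  · rw [le_div_iff₀ h]; linarith [ht.1]
  · rw [div_le_iff₀ h]; linarith [ht.2]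

theorem hasDerivAt_affineMap (a b x : ℝ) : HasDerivAt (affineMap a b) ((b - a) / 2) x := by
  have h := ((hasDerivAt_id x).const_mul ((b - a) / 2)).const_add ((b + a) / 2)
  rw [mul_one] at h
  exact h

theorem contDiff_affineMap {n : WithTop ℕ∞} (a b : ℝ) : ContDiff ℝ n (affineMap a b) := by
  unfold affineMap; fun_prop

theorem ContDiffOn.comp_affineMap {E : Type*} [NormedAddCommGroup E] [NormedSpace ℝ E] {a b : ℝ}
    (hab : a < b) {g : ℝ → E} {n : WithTop ℕ∞} (hg : ContDiffOn ℝ n g (Icc a b)) :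
    ContDiffOn ℝ n (fun x => g (affineMap a b x)) (Icc (-1) 1) :=
  hg.comp (contDiff_affineMap a b).contDiffOn fun _ hx => affineMap_mem hab hx

theorem HasDerivWithinAt.comp_affineMap {E : Type*} [NormedAddCommGroup E] [NormedSpace ℝ E]
    {a b : ℝ} (hab : a < b) {g : ℝ → E} {g' : E} {x : ℝ}
    (hg : HasDerivWithinAt g g' (Icc a b) (affineMap a b x)) :
    HasDerivWithinAt (fun y => g (affineMap a b y)) (((b - a) / 2) • g') (Icc (-1) 1) x :=
  hg.scomp x (hasDerivAt_affineMap a b x).hasDerivWithinAt fun _ hy => affineMap_mem hab hy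

theorem iteratedDerivWithin_comp_affineMap {E : Type*} [NormedAddCommGroup E] [NormedSpace ℝ E]
    {a b : ℝ} (hab : a < b) {g : ℝ → E} {j : ℕ} (hg : ContDiffOn ℝ j g (Icc a b)) {x : ℝ}
    (hx : x ∈ Icc (-1 : ℝ) 1) :
    iteratedDerivWithin j (fun y => g (affineMap a b y)) (Icc (-1) 1) x
      = ((b - a) / 2) ^ j • iteratedDerivWithin j g (Icc a b) (affineMap a b x) := by
  induction j generalizing x with
  | zero => simp
  | succ j ih =>
    have hu := uniqueDiffOn_Icc hab
    have hd := hg.differentiableOn_iteratedDerivWithin (m := j) (by exact_mod_cast Nat.lt_succ_self j)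
      hu _ (affineMap_mem hab hx)
    rw [iteratedDerivWithin_succ, derivWithin_congr
      (fun y hy => ih (hg.of_le (by exact_mod_cast Nat.le_succ j)) hy)
      (ih (hg.of_le (by exact_mod_cast Nat.le_succ j)) hx)]
    have h1 := ((hd.hasDerivWithinAt.comp_affineMap hab).const_smul (((b - a) / 2) ^ j)).derivWithin
      (uniqueDiffOn_ref x hx)
    refine h1.trans ?_
    rw [iteratedDerivWithin_succ, smul_smul, pow_succ]

/-! ### Consequences of the smoothness assumptions -/

theorem contDiffOn_comp_field {d n : ℕ} {s : Set ℝ} {f : ℝ → Vec d → Vec d}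
    (hf : ContDiffOn ℝ n (fun z : ℝ × Vec d => f z.1 z.2) (s ×ˢ univ)) {v : ℝ → Vec d}
    (hv : ContDiffOn ℝ n v s) : ContDiffOn ℝ n (fun t => f t (v t)) s :=
  hf.comp (contDiffOn_id.prodMk hv) fun _ ht => ⟨ht, mem_univ _⟩

/-- Bootstrapping: if `u` is of class `C^l`, so is `u' = f(t,u)`. -/
theorem IsIVPSolution.contDiffOn {d n : ℕ} {t₀ T : ℝ} (hT : 0 < T) {f : ℝ → Vec d → Vec d}
    {u₀ : Vec d} {u : ℝ → Vec d} (hu : IsIVPSolution t₀ T f u₀ u)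
    (hf : ContDiffOn ℝ n (fun z : ℝ × Vec d => f z.1 z.2) (Icc t₀ (t₀ + T) ×ˢ univ)) :
    ContDiffOn ℝ n u (Icc t₀ (t₀ + T)) := by
  have hU : UniqueDiffOn ℝ (Icc t₀ (t₀ + T)) := uniqueDiffOn_Icc (by linarith)
  suffices H : ∀ l ≤ n, ContDiffOn ℝ l u (Icc t₀ (t₀ + T)) from H n le_rfl
  intro l
  induction l with
  | zero =>
    intro _
    exact contDiffOn_zero.2 fun t ht => (hu.2 t ht).continuousWithinAt
  | succ l ih =>
    intro hl
    push_cast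
    rw [contDiffOn_succ_iff_derivWithin hU]
    refine ⟨fun t ht => (hu.2 t ht).differentiableWithinAt, by simp, ?_⟩
    refine (contDiffOn_comp_field (hf.of_le (by exact_mod_cast (Nat.le_succ l).trans hl))
      (ih (by omega))).congr fun t ht => ?_
    exact (hu.2 t ht).derivWithin (hU t ht)

/-- Two continuous functions that agree almost everywhere agree; this is applied to `max F G` and
`G`. It removes the "almost every" from the Lipschitz-type condition. -/
theorem le_of_ae_le_of_continuousOn {a b : ℝ} (hab : a < b) {F G : ℝ → ℝ}
    (hF : ContinuousOn F (Icc a b)) (hG : ContinuousOn G (Icc a b))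
    (h : ∀ᵐ s ∂(volume.restrict (Icc a b)), F s ≤ G s) : ∀ s ∈ Icc a b, F s ≤ G s := by
  have h1 : (fun s => max (F s) (G s)) =ᵐ[volume.restrict (Icc a b)] G := by
    filter_upwards [h] with s hs using max_eq_right hs
  intro s hs
  exact max_eq_right_iff.1 (Measure.eqOn_Icc_of_ae_eq volume hab.ne h1 (hF.sup hG) hG hs)

/-- The pullback multiplies the `i`-th derivative on the left by `((b-a)/2)^i`. The derivatives on
the right have orders `l ≤ i` and need only `((b-a)/2)^l`, which is no smaller as `(b-a)/2 ≤ 1`.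
Hence the constant is independent of the interval. -/
theorem AssDiff.exists_bound {d K : ℕ} {t₀ T : ℝ} (hT : 0 < T) {f : ℝ → Vec d → Vec d}
    (hDiff : AssDiff K t₀ T f)
    (hf : ContDiffOn ℝ K (fun z : ℝ × Vec d => f z.1 z.2) (Icc t₀ (t₀ + T) ×ˢ univ)) :
    ∃ C, 0 ≤ C ∧ ∀ a b : ℝ, t₀ ≤ a → a < b → b ≤ t₀ + T → b - a ≤ 1 → ∀ (v w : ℝ → Vec d) (B : ℝ),
      ContDiffOn ℝ K v (Icc t₀ (t₀ + T)) → ContDiffOn ℝ K w (Icc t₀ (t₀ + T)) →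
      CkBound K B (fun x => v (affineMap a b x) - w (affineMap a b x)) →
      CkBound K (C * B) (fun x => f (affineMap a b x) (v (affineMap a b x))
        - f (affineMap a b x) (w (affineMap a b x))) := by
  obtain ⟨C₂, hC₂⟩ := hDiff
  have hU : UniqueDiffOn ℝ (Icc t₀ (t₀ + T)) := uniqueDiffOn_Icc (by linarith)
  refine ⟨|C₂| * (K + 1), by positivity, fun a b ha hab hb hh v w B hv hw hB => ?_⟩
  have hsub : Icc a b ⊆ Icc t₀ (t₀ + T) := Icc_subset_Icc ha hb
  have hUJ := uniqueDiffOn_Icc hab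
  have hvw : ContDiffOn ℝ K (fun t => v t - w t) (Icc t₀ (t₀ + T)) := hv.sub hw
  have hF : ContDiffOn ℝ K (fun t => f t (v t) - f t (w t)) (Icc t₀ (t₀ + T)) :=
    (contDiffOn_comp_field hf hv).sub (contDiffOn_comp_field hf hw)
  refine ⟨(hF.mono hsub).comp_affineMap hab, fun i hi x hx => ?_⟩
  have hiK : (i : WithTop ℕ∞) ≤ (K : WithTop ℕ∞) := by exact_mod_cast hi
  have hpt := le_of_ae_le_of_continuousOn (by linarith : t₀ < t₀ + T)
    (hF.continuousOn_iteratedDerivWithin hiK hU).norm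
    (continuousOn_const.mul (continuousOn_finsetSum _ fun l hl =>
      (hvw.continuousOn_iteratedDerivWithin (m := l) (by
        have := Finset.mem_range.1 hl
        exact_mod_cast (by omega : l ≤ K)) hU).norm))
    (hC₂ i hi v w hv hw) _ (hsub (affineMap_mem hab hx))
  rw [iteratedDerivWithin_comp_affineMap (g := fun t => f t (v t) - f t (w t)) hab
    ((hF.mono hsub).of_le hiK) hx,
    iteratedDerivWithin_of_subset hsub hUJ hU (hF.of_le hiK) (affineMap_mem hab hx), norm_smul,
    norm_pow, Real.norm_eq_abs, abs_of_pos (by linarith : 0 < (b - a) / 2)]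
  have hδ0 : 0 < (b - a) / 2 := by linarith
  have hδ1 : (b - a) / 2 ≤ 1 := by linarith
  have hB0 := hB.nonneg
  have hterm : ∀ l ∈ Finset.range (i + 1), ((b - a) / 2) ^ i *
      ‖iteratedDerivWithin l (fun t => v t - w t) (Icc t₀ (t₀ + T)) (affineMap a b x)‖ ≤ B := by
    intro l hl
    have hli : l ≤ i := Nat.lt_succ_iff.1 (Finset.mem_range.1 hl)
    have hlK : (l : WithTop ℕ∞) ≤ (K : WithTop ℕ∞) := by exact_mod_cast hli.trans hi
    have h1 := hB.bound l (hli.trans hi) x hx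
    rw [iteratedDerivWithin_comp_affineMap (g := fun t => v t - w t) hab
      ((hvw.mono hsub).of_le hlK) hx,
      iteratedDerivWithin_of_subset hsub hUJ hU (hvw.of_le hlK) (affineMap_mem hab hx), norm_smul,
      norm_pow, Real.norm_eq_abs, abs_of_pos hδ0] at h1
    refine le_trans (mul_le_mul_of_nonneg_right ?_ (norm_nonneg _)) h1
    exact pow_le_pow_of_le_one hδ0.le hδ1 hli
  calc ((b - a) / 2) ^ i * _ ≤ ((b - a) / 2) ^ i * (|C₂| * ∑ l ∈ Finset.range (i + 1),
        ‖iteratedDerivWithin l (fun t => v t - w t) (Icc t₀ (t₀ + T)) (affineMap a b x)‖) := by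
        refine mul_le_mul_of_nonneg_left (hpt.trans ?_) (by positivity)
        exact mul_le_mul_of_nonneg_right (le_abs_self _)
          (Finset.sum_nonneg fun _ _ => norm_nonneg _)
    _ = |C₂| * ∑ l ∈ Finset.range (i + 1), ((b - a) / 2) ^ i *
        ‖iteratedDerivWithin l (fun t => v t - w t) (Icc t₀ (t₀ + T)) (affineMap a b x)‖ := by
        rw [← Finset.mul_sum]; ring
    _ ≤ |C₂| * ((i + 1 : ℕ) • B) := by
        refine mul_le_mul_of_nonneg_left ?_ (abs_nonneg _)
        simpa using Finset.sum_le_card_nsmul _ _ B hterm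
    _ ≤ |C₂| * (K + 1) * B := by
        rw [mul_assoc, nsmul_eq_mul]
        refine mul_le_mul_of_nonneg_left (mul_le_mul_of_nonneg_right ?_ hB0) (abs_nonneg _)
        push_cast
        have : (i : ℝ) ≤ K := by exact_mod_cast hi
        linarith

/-- Local approximation of a smooth function by polynomials of degree less than `m`. -/
theorem exists_local_taylor {d K M : ℕ} {t₀ T : ℝ} (hT : 0 < T) {w : ℝ → Vec d}
    (hw : ContDiffOn ℝ (max K M : ℕ) w (Icc t₀ (t₀ + T))) :
    ∃ C, 0 ≤ C ∧ ∀ a b : ℝ, t₀ ≤ a → a < b → b ≤ t₀ + T → b - a ≤ 1 → ∀ m ≤ M, ∀ i : Fin d,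
      ∃ q ∈ degreeLT ℝ m, CkBound K (C * (b - a) ^ m)
        (fun x => w (affineMap a b x) i - q.eval x) := by
  have hU : UniqueDiffOn ℝ (Icc t₀ (t₀ + T)) := uniqueDiffOn_Icc (by linarith)
  have h1 : ∀ j ∈ Finset.range (max K M + 1), ∃ B : ℝ, ∀ x ∈ Icc t₀ (t₀ + T),
      ‖iteratedDerivWithin j w (Icc t₀ (t₀ + T)) x‖ ≤ B := fun j hj =>
    isCompact_Icc.exists_bound_of_continuousOn (hw.continuousOn_iteratedDerivWithin
      (by exact_mod_cast Nat.lt_succ_iff.1 (Finset.mem_range.1 hj)) hU)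
  choose! β hβ using h1
  set D := ∑ j ∈ Finset.range (max K M + 1), |β j| with hD
  have hD0 : 0 ≤ D := Finset.sum_nonneg fun _ _ => abs_nonneg _
  refine ⟨2 ^ M * D, by positivity, fun a b ha hab hb hh m hm i => ?_⟩
  have hsub : Icc a b ⊆ Icc t₀ (t₀ + T) := Icc_subset_Icc ha hb
  have hmK : max K m ≤ max K M := max_le_max_left K hm
  have hwi : ContDiffOn ℝ (max K m : ℕ) (fun t => w t i) (Icc t₀ (t₀ + T)) :=
    (EuclideanSpace.proj i : Vec d →L[ℝ] ℝ).contDiff.comp_contDiffOn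
      (hw.of_le (by exact_mod_cast hmK))
  have hh0 : 0 < b - a := by linarith
  have hder : ∀ j, m ≤ j → j ≤ max K m → ∀ x ∈ Icc (-1 : ℝ) 1,
      |iteratedDerivWithin j (fun x => w (affineMap a b x) i) (Icc (-1) 1) x|
        ≤ (b - a) ^ m * D := by
    intro j hmj hj x hx
    have hjW : (j : WithTop ℕ∞) ≤ ((max K m : ℕ) : WithTop ℕ∞) := by exact_mod_cast hj
    have hjW' : (j : WithTop ℕ∞) ≤ ((max K M : ℕ) : WithTop ℕ∞) := by exact_mod_cast hj.trans hmK
    have hx' := affineMap_mem hab hx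
    rw [iteratedDerivWithin_comp_affineMap (g := fun t => w t i) hab ((hwi.mono hsub).of_le hjW) hx,
      iteratedDerivWithin_of_subset hsub (uniqueDiffOn_Icc hab) hU (hwi.of_le hjW) hx']
    have h3 := iteratedDerivWithin_clm_comp (EuclideanSpace.proj i : Vec d →L[ℝ] ℝ)
      (hw.of_le hjW') hU (hsub hx')
    change iteratedDerivWithin j (fun t => w t i) _ _ = _ at h3
    have hjr : j ∈ Finset.range (max K M + 1) := Finset.mem_range.2 (by omega)
    have h4 : |iteratedDerivWithin j (fun t => w t i) (Icc t₀ (t₀ + T)) (affineMap a b x)| ≤ D := by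
      rw [h3]
      refine (PiLp.norm_apply_le _ i).trans ((hβ j hjr _ (hsub hx')).trans ?_)
      exact (le_abs_self _).trans
        (Finset.single_le_sum (f := fun j => |β j|) (fun _ _ => abs_nonneg _) hjr)
    rw [smul_eq_mul, abs_mul, abs_of_nonneg (by positivity)]
    refine mul_le_mul ?_ h4 (abs_nonneg _) (by positivity)
    -- Only derivatives of order `j ≥ m` enter the remainder, and each carries `((b-a)/2)^j ≤
    -- (b-a)^m`.
    exact (pow_le_pow_left₀ (by positivity) (by linarith) j).trans
      (pow_le_pow_of_le_one hh0.le hh hmj)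
  obtain ⟨q, hq, hB⟩ := exists_taylor_approx (n := K) (m := m)
    ((hwi.mono hsub).comp_affineMap hab) hder
  refine ⟨q, hq, hB.weaken ?_⟩
  have h2 : (2 : ℝ) ^ m ≤ 2 ^ M := pow_le_pow_right₀ (by norm_num) hm
  calc (2 : ℝ) ^ m * ((b - a) ^ m * D) ≤ 2 ^ M * ((b - a) ^ m * D) :=
        mul_le_mul_of_nonneg_right h2 (by positivity)
    _ = _ := by ring

/-! ### The local problem on the reference interval -/

theorem comp_linear_mem_degreeLT {r : ℕ} {p : ℝ[X]} (hp : p ∈ degreeLT ℝ r) (α β : ℝ) :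
    p.comp (C α + C β * X) ∈ degreeLT ℝ r := by
  rcases eq_or_ne p 0 with rfl | h0
  · simp
  have h1 : (C α + C β * X : ℝ[X]).natDegree ≤ 1 := by
    rw [add_comm]; exact natDegree_linear_le
  have h2 := (natDegree_lt_iff_degree_lt h0).2 (mem_degreeLT.1 hp)
  have h3 : (p.comp (C α + C β * X)).natDegree < r :=
    (natDegree_comp_le.trans (Nat.mul_le_mul_left _ h1)).trans_lt (by omega)
  exact mem_degreeLT.2 (degree_le_natDegree.trans_lt (by exact_mod_cast h3))

theorem isVecPoly_eval_smul {d m : ℕ} {q : ℝ[X]} (hq : q ∈ degreeLT ℝ (m + 1)) (v : Vec d) :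
    IsVecPoly m (fun t => q.eval t • v) := by
  refine ⟨fun j => q.coeff j • v, ?_⟩
  funext t
  rw [eval_eq_sum_of_mem_degreeLT hq, Finset.sum_smul]
  exact Finset.sum_congr rfl fun j _ => by rw [smul_smul, mul_comm]

theorem IsVecPoly.exists_eval {d m : ℕ} {p : ℝ → Vec d} (hp : IsVecPoly m p) (i : Fin d) :
    ∃ q ∈ degreeLT ℝ (m + 1), ∀ t, p t i = q.eval t := by
  obtain ⟨c, rfl⟩ := hp
  refine ⟨∑ j ∈ Finset.range (m + 1), monomial j (c j i), Submodule.sum_mem _ fun j hj => ?_,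
    fun t => ?_⟩
  · exact mem_degreeLT.2 ((degree_monomial_le _ _).trans_lt
      (by exact_mod_cast Finset.mem_range.1 hj))
  · simp [eval_finsetSum, mul_comm]

theorem IsVecPoly.contDiff {d m : ℕ} {p : ℝ → Vec d} (hp : IsVecPoly m p) {n : WithTop ℕ∞} :
    ContDiff ℝ n p := by
  obtain ⟨c, rfl⟩ := hp
  fun_prop

/-- The components of the derivative of a local solution solve the discrete equations on the
reference interval. -/
theorem IsLocalSolution.reference {d r k K : ℕ} {Q : (ℝ → ℝ) → ℝ} {A : (ℝ → ℝ) → ℝ → ℝ}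
    {f : ℝ → Vec d → Vec d} {a b : ℝ} {Ua : Vec d} {p : ℝ → Vec d} (hab : a < b)
    (hp : IsLocalSolution r k Q A f a b Ua p)
    (hfp : ContDiffOn ℝ K (fun t => f t (p t)) (Icc a b)) (hkK : k / 2 - 1 ≤ K) (i : Fin d) :
    ∃ P ∈ degreeLT ℝ r, (∀ x, deriv p (affineMap a b x) i = P.eval x) ∧
      (∀ j < k / 2, (derivative^[j] P).eval 1 = iteratedDerivWithin j
        (fun x => f (affineMap a b x) (p (affineMap a b x)) i) (Icc (-1) 1) 1) ∧
      (∀ j < (k - 1) / 2, (derivative^[j] P).eval (-1) = iteratedDerivWithin j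
        (fun x => f (affineMap a b x) (p (affineMap a b x)) i) (Icc (-1) 1) (-1)) ∧
      (∀ ψ ∈ degreeLT ℝ (r - k + 1),
        (b - a) / 2 * Q (fun x => P.eval x * ψ.eval x) + (p a i - Ua i) * ψ.eval (-1)
          = (b - a) / 2 * Q (fun x =>
              A (fun x => f (affineMap a b x) (p (affineMap a b x)) i) x * ψ.eval x)) := by
  obtain ⟨p₀, hp₀, hpe⟩ := hp.poly.exists_eval i
  have hcd : ∀ {n : WithTop ℕ∞}, ContDiff ℝ n p := hp.poly.contDiff
  have hderiv : ∀ (j : ℕ) (t : ℝ), iteratedDeriv j p t i = (derivative^[j] p₀).eval t := by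
    intro j t
    have h := iteratedDerivWithin_clm_comp (EuclideanSpace.proj i : Vec d →L[ℝ] ℝ)
      (hcd (n := j)).contDiffOn uniqueDiffOn_univ (mem_univ t)
    simp only [iteratedDerivWithin_univ] at h
    change iteratedDeriv j (fun y => p y i) t = _ at h
    rw [funext hpe, iteratedDeriv_eval] at h
    exact h.symm
  have hd1 : ∀ t, deriv p t i = (derivative p₀).eval t := fun t => by
    simpa using hderiv 1 t
  have hp₀' : derivative p₀ ∈ degreeLT ℝ r := by
    rw [mem_degreeLT]
    have h := mem_degreeLT.1 hp₀
    rcases eq_or_ne p₀ 0 with rfl | h0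
    · simp
    rcases eq_or_ne (derivative p₀) 0 with h1 | h1
    · rw [h1]; simp
    have h2 := degree_derivative_lt h0
    have h3 := (natDegree_lt_iff_degree_lt h0).2 h
    rw [degree_eq_natDegree h1, degree_eq_natDegree h0] at h2
    rw [degree_eq_natDegree h1]
    have h4 : (derivative p₀).natDegree < p₀.natDegree := by exact_mod_cast h2
    exact_mod_cast (by omega : (derivative p₀).natDegree < r)
  -- `P` is the pullback of `p'`, not the derivative of the pullback of `p`; no factor `(b-a)/2` is
  -- included.
  set P := (derivative p₀).comp (C ((b + a) / 2) + C ((b - a) / 2) * X) with hP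
  have hPe : ∀ x, P.eval x = (derivative p₀).eval (affineMap a b x) := fun x => by
    simp [hP, affineMap]
  -- Both sides of a boundary condition acquire the same factor `((b-a)/2)^j` under the pullback.
  have hbdry : ∀ j < k / 2, ∀ x ∈ Icc (-1 : ℝ) 1,
      iteratedDeriv (j + 1) p (affineMap a b x)
        = iteratedDerivWithin j (fun t => f t (p t)) (Icc a b) (affineMap a b x) →
      (derivative^[j] P).eval x = iteratedDerivWithin j
        (fun x => f (affineMap a b x) (p (affineMap a b x)) i) (Icc (-1) 1) x := by
    intro j hj x hx h
    have hfj : ContDiffOn ℝ j (fun t => f t (p t)) (Icc a b) :=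
      hfp.of_le (by exact_mod_cast (by omega : j ≤ K))
    have hx' := affineMap_mem hab hx
    rw [iteratedDerivWithin_comp_affineMap (g := fun t => f t (p t) i) hab
      ((EuclideanSpace.proj i : Vec d →L[ℝ] ℝ).contDiff.comp_contDiffOn hfj) hx]
    have h3 := iteratedDerivWithin_clm_comp (EuclideanSpace.proj i : Vec d →L[ℝ] ℝ) hfj
      (uniqueDiffOn_Icc hab) hx'
    change iteratedDerivWithin j (fun t => f t (p t) i) _ _ = _ at h3
    rw [h3, ← h, ← iteratedDerivWithin_eval j P uniqueDiffOn_ref hx, funext hPe,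
      iteratedDerivWithin_comp_affineMap (g := fun t => (derivative p₀).eval t) hab
        (contDiffOn_eval _ _ _) hx, iteratedDerivWithin_eval _ _ (uniqueDiffOn_Icc hab) hx']
    congr 1
    rw [← Function.iterate_succ_apply, ← hderiv]
    rfl
  refine ⟨P, comp_linear_mem_degreeLT hp₀' _ _, fun x => by rw [hd1, hPe], fun j hj => ?_,
    fun j hj => ?_, fun ψ hψ => ?_⟩
  · refine hbdry j hj 1 (by simp) ?_
    rw [affineMap_one]; exact hp.right j hj
  · refine hbdry j (by omega) (-1) (by simp) ?_
    rw [affineMap_neg_one]; exact hp.left j hj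
  · set v : Vec d := EuclideanSpace.single i 1 with hv
    -- `ψ` is transported to `[a,b]`; testing with it in the direction of the `i`-th basis vector
    -- isolates the `i`-th component.
    set φ : ℝ[X] := ψ.comp (C (-(b + a) / (b - a)) + C (2 / (b - a)) * X) with hφ
    have hφe : ∀ x, φ.eval (affineMap a b x) = ψ.eval x := fun x => by
      rw [hφ, eval_comp]
      congr 1
      have : b - a ≠ 0 := by linarith
      simp only [eval_add, eval_C, eval_mul, eval_X, affineMap]
      field_simp; ring
    have h := hp.variational (fun t => φ.eval t • v)
      (isVecPoly_eval_smul (comp_linear_mem_degreeLT hψ _ _) v)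
    have hin : ∀ (y : Vec d) (c : ℝ), inner ℝ y (c • v) = y i * c := fun y c => by
      rw [inner_smul_right, hv, EuclideanSpace.inner_single_right]
      simp [mul_comm]
    simp only [hin, localInt, hφe, hd1, ← hPe, vecApprox, localApprox,
      affineInv_affineMap hab] at h
    have ha : φ.eval a = ψ.eval (-1) := by
      rw [← hφe, affineMap_neg_one]
    rw [← h, ha]
    -- For `k ≥ 1` continuity at `a` makes the jump term vanish, so one identity covers all `k`.
    rcases Nat.eq_zero_or_pos k with hk | hk
    · simp [hk]
    · simp [hk.ne', hp.initial hk]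

/-! ### Local error estimates -/

theorem norm_le_card_mul {d : ℕ} {v : Vec d} {B : ℝ} (h : ∀ i, |v i| ≤ B) : ‖v‖ ≤ d * B := by
  have h1 : v = ∑ i, v i • (EuclideanSpace.basisFun (Fin d) ℝ i) := by
    simpa using ((EuclideanSpace.basisFun (Fin d) ℝ).sum_repr v).symm
  rw [h1]
  refine (norm_sum_le _ _).trans ((Finset.sum_le_card_nsmul _ _ B fun i _ => ?_).trans (by simp))
  simpa [norm_smul] using h i

theorem CkBound.of_apply {d n : ℕ} {B : ℝ} {φ : ℝ → Vec d}
    (h : ∀ i, CkBound n B (fun x => φ x i)) : CkBound n (d * B) φ := by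
  have hs : ContDiffOn ℝ n φ (Icc (-1) 1) := contDiffOn_piLp' _ fun i => (h i).smooth
  refine ⟨hs, fun j hj x hx => norm_le_card_mul fun i => ?_⟩
  have h1 := iteratedDerivWithin_clm_comp (EuclideanSpace.proj i : Vec d →L[ℝ] ℝ)
    (hs.of_le (by exact_mod_cast hj)) uniqueDiffOn_ref hx
  change iteratedDerivWithin j (fun x => φ x i) _ x = _ at h1
  have h2 := (h i).bound j hj x hx
  rw [h1] at h2
  exact h2

theorem IsRefIntegrator.sub {kI : ℕ} {Q : (ℝ → ℝ) → ℝ} (hQ : IsRefIntegrator kI Q) {φ ψ : ℝ → ℝ}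
    (hφ : ContDiffOn ℝ kI φ (Icc (-1) 1)) (hψ : ContDiffOn ℝ kI ψ (Icc (-1) 1)) :
    Q (fun x => φ x - ψ x) = Q φ - Q ψ := by
  have h1 := hQ.add φ (fun x => (-1) * ψ x) hφ (contDiffOn_const.mul hψ)
  rw [hQ.smul (-1) ψ hψ] at h1
  rw [sub_eq_add_neg, ← neg_one_mul, ← h1]
  congr 1; funext x; ring

theorem IsRefApproximation.sub {kA : ℕ} {A : (ℝ → ℝ) → ℝ → ℝ} (hA : IsRefApproximation kA A)
    {φ ψ : ℝ → ℝ} (hφ : ContDiffOn ℝ kA φ (Icc (-1) 1)) (hψ : ContDiffOn ℝ kA ψ (Icc (-1) 1)) :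
    EqOn (A (fun x => φ x - ψ x)) (fun x => A φ x - A ψ x) (Icc (-1) 1) := by
  intro x hx
  have h1 := hA.add φ (fun x => (-1) * ψ x) hφ (contDiffOn_const.mul hψ) hx
  have h2 := hA.smul (-1) ψ hψ hx
  have h3 : (fun x => φ x - ψ x) = fun x => φ x + (-1) * ψ x := by funext y; ring
  rw [h3, h1]
  dsimp only at h2 ⊢
  rw [h2]; ring

/-- This permits subtracting a Taylor polynomial on the right-hand side. As `A` is linear only up to
values off `[-1,1]`, `Q` must be insensitive to these. -/
theorem int_approx_sub {kI kA : ℕ} {Q : (ℝ → ℝ) → ℝ} (hQ : IsRefIntegrator kI Q)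
    {A : (ℝ → ℝ) → ℝ → ℝ} (hA : IsRefApproximation kA A) {g : ℝ → ℝ}
    (hg : ContDiffOn ℝ (max kA kI : ℕ) g (Icc (-1) 1)) (q ψ : ℝ[X]) :
    Q (fun x => A (fun y => g y - q.eval y) x * ψ.eval x)
      = Q (fun x => A g x * ψ.eval x) - Q (fun x => A (fun y => q.eval y) x * ψ.eval x) := by
  have hq := fun n : ℕ => contDiffOn_eval n q (Icc (-1) 1)
  have hψ := contDiffOn_eval kI ψ (Icc (-1) 1)
  have hgA : ContDiffOn ℝ kA g (Icc (-1) 1) := hg.of_le (by exact_mod_cast le_max_left kA kI)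
  rw [← hQ.sub ((hA.smooth kI g hg).mul hψ) ((hA.smooth kI _ (hq _)).mul hψ)]
  refine hQ.congr _ _ ((hA.smooth kI _ (hg.sub (hq _))).mul hψ) fun x hx => ?_
  have h := hA.sub hgA (hq kA) hx
  dsimp only at h ⊢
  rw [h]; ring

/-- Resolution of the implicit inequality for the local error. -/
theorem local_bound_arith {d c1 c2 c3 c4 h Z η W c5 c6 α β : ℝ} (hd : 0 ≤ d)
    (h1 : 0 ≤ c1) (h2 : 0 ≤ c2) (h3 : 0 ≤ c3) (h4 : 0 ≤ c4) (hh : 0 < h) (hh1 : h ≤ 1)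
    (hZ : 0 ≤ Z) (hη : 0 ≤ η) (hW : 0 ≤ W)
    (hα : α = d * c4 * c3 * d) (hβ : β = d * c4 * c1)
    (h5 : c5 = 2 * (α + α * c1 + β)) (h6 : c6 = 1 + c1 + c2 * c5)
    (hsmall : h * (α * c2) ≤ 1 / 2)
    (hWb : W ≤ d * (c4 * (c3 * (d * (η + h * (c1 * Z + c2 * W))) + c1 * Z))) :
    W ≤ c5 * (η + Z) ∧ η + h * (c1 * Z + c2 * W) ≤ c6 * (η + h * Z) := by
  have hα0 : 0 ≤ α := by rw [hα]; positivity
  have hβ0 : 0 ≤ β := by rw [hβ]; positivity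
  have h50 : 0 ≤ c5 := by rw [h5]; positivity
  have e1 : W ≤ α * η + α * c1 * (h * Z) + h * (α * c2) * W + β * Z := by
    refine hWb.trans (le_of_eq ?_); rw [hα, hβ]; ring
  -- Half of `W` is absorbed on the left, whence the factor `2` in `c5`.
  have e2 : h * (α * c2) * W ≤ 1 / 2 * W := mul_le_mul_of_nonneg_right hsmall hW
  have e3 : α * c1 * (h * Z) ≤ α * c1 * Z :=
    mul_le_mul_of_nonneg_left (mul_le_of_le_one_left hZ hh1) (by positivity)
  have e4 : 0 ≤ α * Z + α * c1 * η + β * η := by positivity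
  have hWc : W ≤ c5 * (η + Z) := by rw [h5]; linarith
  refine ⟨hWc, ?_⟩
  have e5 : h * (c2 * W) ≤ h * (c2 * (c5 * (η + Z))) := by gcongr
  have e6 : h * (c2 * c5 * η) ≤ c2 * c5 * η := mul_le_of_le_one_left (by positivity) hh1
  have e7 : 0 ≤ c1 * η + h * Z := by positivity
  rw [h6]
  linarith

/-- The second absorption. Because of the jump, the error `η` of the right limit at `a` is itself
known only up to `h (η + Z)`; for small `h` it is replaced by the error `ε` of the given left value.
The three summands of the common constant belong to the jump, the right-hand side and the
derivative. -/
theorem local_bound_arith_final {a6 a5 c1 c7 h Z η ε : ℝ} (h6 : 0 ≤ a6) (h5 : 0 ≤ a5) (h1 : 0 ≤ c1)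
    (h7 : 0 ≤ c7) (hh : 0 < h) (hZ : 0 ≤ Z) (hη : 0 ≤ η) (hε : 0 ≤ ε) (hs : h * c7 ≤ 1 / 2)
    (hηε : η ≤ ε + c7 * (h * (η + Z))) :
    c7 * (h * (η + Z)) ≤ (2 * c7 + a6 * (3 + 2 * c7) + (c1 + 2 * a5)) * (h * (ε + Z)) ∧
    a6 * (η + h * Z) ≤ (2 * c7 + a6 * (3 + 2 * c7) + (c1 + 2 * a5)) * (ε + h * Z) ∧
    c1 * Z + a5 * (η + Z) ≤ (2 * c7 + a6 * (3 + 2 * c7) + (c1 + 2 * a5)) * (ε + Z) := by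
  have e1 : h * c7 * η ≤ 1 / 2 * η := mul_le_mul_of_nonneg_right hs hη
  have e2 : h * c7 * Z ≤ 1 / 2 * Z := mul_le_mul_of_nonneg_right hs hZ
  have hη1 : η ≤ 2 * ε + 2 * c7 * (h * Z) := by linarith
  have hη2 : η ≤ 2 * ε + Z := by linarith
  have hεZ' : 0 ≤ ε + Z := by positivity
  have hεZ : 0 ≤ h * (ε + Z) := by positivity
  have hεhZ : 0 ≤ ε + h * Z := by positivity
  have hX : 0 ≤ a6 * (3 + 2 * c7) := by positivity
  refine ⟨?_, ?_, ?_⟩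
  · have e : c7 * (h * (η + Z)) ≤ c7 * (h * (2 * (ε + Z))) := by gcongr; linarith
    have := mul_nonneg hX hεZ
    have := mul_nonneg h1 hεZ
    have := mul_nonneg h5 hεZ
    linarith
  · have g2 : η + h * Z ≤ (3 + 2 * c7) * (ε + h * Z) := by
      have g5 : 0 ≤ c7 * ε := by positivity
      have g6 : 0 ≤ h * Z := by positivity
      linarith
    have g3 := mul_le_mul_of_nonneg_left g2 h6
    have := mul_nonneg h7 hεhZ
    have := mul_nonneg h1 hεhZ
    have := mul_nonneg h5 hεhZ
    linarith
  · have g2 : a5 * (η + Z) ≤ a5 * (2 * (ε + Z)) := by gcongr; linarith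
    have := mul_nonneg hX hεZ'
    have := mul_nonneg h1 hε
    have := mul_nonneg h7 hεZ'
    linarith

theorem abs_half_mul_sub_le {h x y X Y : ℝ} (hh : 0 ≤ h) (hx : |x| ≤ X) (hy : |y| ≤ Y) :
    |h / 2 * (x - y)| ≤ h * (X + Y) := by
  have e : |x - y| ≤ X + Y := by
    rw [abs_le] at hx hy ⊢
    constructor <;> linarith
  rw [abs_mul, abs_of_nonneg (by linarith)]
  exact mul_le_mul (by linarith) e (abs_nonneg _) hh

set_option maxHeartbeats 1000000 in
/-- The jump, the error of the right-hand side and the error of the derivative on one interval. -/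
theorem exists_local_bound {d r k kI kA : ℕ} (hkr : k ≤ r) (i₀ : Fin d)
    {Q : (ℝ → ℝ) → ℝ} (hQ : IsRefIntegrator kI Q)
    {A : (ℝ → ℝ) → ℝ → ℝ} (hA : IsRefApproximation kA A)
    {t₀ T : ℝ} (hT : 0 < T) {f : ℝ → Vec d → Vec d} {u₀ : Vec d} {u : ℝ → Vec d}
    (hf : ContDiffOn ℝ (max (kJ k kI kA) (r + 1) : ℕ) (fun z : ℝ × Vec d => f z.1 z.2)
      (Icc t₀ (t₀ + T) ×ˢ univ))
    (hu : IsIVPSolution t₀ T f u₀ u) (hInt : AssIntegrator r k Q) (hSupInt : AssSupIntegrator d kI Q)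
    (hSup : AssSupApprox d kI kA A) (hDiff : AssDiff (kJ k kI kA) t₀ T f)
    {m : ℕ} (hm : m ≤ r)
    (hrA : ∀ q ∈ degreeLT ℝ m, ∀ ψ ∈ degreeLT ℝ (r - k + 1),
      Q (fun x => q.eval x * ψ.eval x) = Q (fun x => A (fun y => q.eval y) x * ψ.eval x)) :
    ∃ C, 0 ≤ C ∧ ∃ h₀ > 0, h₀ ≤ 1 ∧ ∀ a b : ℝ, t₀ ≤ a → a < b → b ≤ t₀ + T → b - a ≤ h₀ →
      ∀ (Ua : Vec d) (p : ℝ → Vec d), IsLocalSolution r k Q A f a b Ua p →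
        ‖p a - Ua‖ ≤ C * ((b - a) * (‖u a - Ua‖ + (b - a) ^ m)) ∧
        CkBound (kJ k kI kA) (C * (‖u a - Ua‖ + (b - a) * (b - a) ^ m))
          (fun x => f (affineMap a b x) (u (affineMap a b x))
            - f (affineMap a b x) (p (affineMap a b x))) ∧
        ∀ i, CkBound (kJ k kI kA) (C * (‖u a - Ua‖ + (b - a) ^ m))
          (fun x => f (affineMap a b x) (u (affineMap a b x)) i - deriv p (affineMap a b x) i) := by
  set K := kJ k kI kA with hK
  have hkK : k / 2 - 1 ≤ K := le_max_left _ _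
  have hAI : max kA kI ≤ K := by rw [hK, kJ, max_comm kA kI]; exact le_max_right _ _
  have hfK := hf.of_le (m := (K : WithTop ℕ∞)) (by exact_mod_cast le_max_left K (r + 1))
  have huC := hu.contDiffOn hT hf
  have huK := huC.of_le (m := (K : WithTop ℕ∞)) (by exact_mod_cast le_max_left K (r + 1))
  obtain ⟨CQ, hCQ0, hCQ⟩ := hSupInt.exists_bound i₀
  obtain ⟨CA, hCA0, hCA⟩ := hA.exists_bound hSup i₀
  obtain ⟨c4, hc4, hstab⟩ := exists_stability hkr hQ hInt hCQ0 hCQ hCA0 hCA hAI hkK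
  obtain ⟨c3, hc3, hfd⟩ := hDiff.exists_bound hT hfK
  obtain ⟨c2, hc2, hpoly⟩ := exists_ckBound_eval K r
  obtain ⟨c1, hc1, htay⟩ := exists_local_taylor hT (contDiffOn_comp_field hf huC)
  obtain ⟨α, hα⟩ : ∃ α : ℝ, α = d * c4 * c3 * d := ⟨_, rfl⟩
  obtain ⟨β, hβ⟩ : ∃ β : ℝ, β = d * c4 * c1 := ⟨_, rfl⟩
  obtain ⟨c5, hc5e⟩ : ∃ c5 : ℝ, c5 = 2 * (α + α * c1 + β) := ⟨_, rfl⟩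
  obtain ⟨c6, hc6e⟩ : ∃ c6 : ℝ, c6 = 1 + c1 + c2 * c5 := ⟨_, rfl⟩
  obtain ⟨c7, hc7e⟩ : ∃ c7 : ℝ, c7 = d * (CQ * (CA * (c3 * (d * c6) + c1)) + CQ * (c2 * c5)) :=
    ⟨_, rfl⟩
  have hd0 : (0 : ℝ) ≤ d := Nat.cast_nonneg d
  have hα0 : 0 ≤ α := by rw [hα]; positivity
  have hβ0 : 0 ≤ β := by rw [hβ]; positivity
  have hc5 : 0 ≤ c5 := by rw [hc5e]; positivity
  have hc6 : 0 ≤ c6 := by rw [hc6e]; positivity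
  have hc7 : 0 ≤ c7 := by rw [hc7e]; positivity
  -- With `h ≤ 1 / (2 S)` both absorptions are possible, with the factors `α * c2` and `c7`; the
  -- summand `1` ensures `h ≤ 1`.
  set S : ℝ := α * c2 + c7 + 1 with hS
  have hS1 : 1 ≤ S := by have := mul_nonneg hα0 hc2; rw [hS]; linarith
  refine ⟨2 * c7 + c3 * (d * c6) * (3 + 2 * c7) + (c1 + 2 * (c2 * c5)), by positivity, 1 / (2 * S),
    by positivity, by rw [div_le_one (by positivity)]; linarith, fun a b ha hab hb hh Ua p hp => ?_⟩
  have hsub : Icc a b ⊆ Icc t₀ (t₀ + T) := Icc_subset_Icc ha hb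
  obtain ⟨h, hhe⟩ : ∃ h, h = b - a := ⟨_, rfl⟩
  obtain ⟨Z, hZe⟩ : ∃ Z, Z = (b - a) ^ m := ⟨_, rfl⟩
  obtain ⟨η, hηe⟩ : ∃ η, η = ‖u a - p a‖ := ⟨_, rfl⟩
  obtain ⟨ε, hεe⟩ : ∃ ε, ε = ‖u a - Ua‖ := ⟨_, rfl⟩
  rw [← hεe, ← hZe, ← hhe]
  have hh0 : 0 < h := by linarith
  have hZ0 : 0 ≤ Z := by rw [hZe, ← hhe]; positivity
  have hη0 : 0 ≤ η := by rw [hηe]; positivity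
  have hε0 : 0 ≤ ε := by rw [hεe]; positivity
  have hhS : h * S ≤ 1 / 2 := by
    rw [le_div_iff₀ (by positivity)] at hh
    rw [hhe]; linarith
  have hα2 : 0 ≤ α * c2 := by positivity
  have hh1 : h ≤ 1 := by nlinarith
  have hs1 : h * (α * c2) ≤ 1 / 2 := by rw [hS] at hhS; nlinarith
  have hs2 : h * c7 ≤ 1 / 2 := by rw [hS] at hhS; nlinarith
  have hpC : ContDiffOn ℝ K p (Icc t₀ (t₀ + T)) := hp.poly.contDiff.contDiffOn
  have hfp : ContDiffOn ℝ K (fun t => f t (p t)) (Icc a b) :=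
    (contDiffOn_comp_field hfK hpC).mono hsub
  choose P hPr hPe hPright hPleft hPvar using fun i => hp.reference hab hfp hkK i
  -- Taylor polynomials of the components of `u'`. As `m ≤ r`, the difference `P i - q i` stays in
  -- the space covered by the stability estimate.
  choose q hqm hq using fun i => htay a b ha hab hb (by linarith) m (by omega) i
  rw [← hZe] at hq
  have hqr : ∀ i, q i ∈ degreeLT ℝ r := fun i => degreeLT_mono hm (hqm i)
  have hRr : ∀ i, P i - q i ∈ degreeLT ℝ r := fun i => Submodule.sub_mem _ (hPr i) (hqr i)
  obtain ⟨W, hWe⟩ : ∃ W, W = ∑ i, coeffNorm r (P i - q i) := ⟨_, rfl⟩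
  have hW0 : 0 ≤ W := by rw [hWe]; exact Finset.sum_nonneg fun i _ => coeffNorm_nonneg _ _
  have hR : ∀ i, CkBound K (c2 * W) (fun x => (P i - q i).eval x) := fun i =>
    (hpoly _ (hRr i)).weaken (mul_le_mul_of_nonneg_left (by
      rw [hWe]
      exact Finset.single_le_sum (f := fun i => coeffNorm r (P i - q i))
        (fun j _ => coeffNorm_nonneg _ _) (Finset.mem_univ i)) hc2)
  have hD : ∀ i, CkBound K (c1 * Z + c2 * W)
      (fun x => f (affineMap a b x) (u (affineMap a b x)) i - (P i).eval x) := fun i =>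
    ((hq i).sub (hR i)).congr fun x _ => by simp
  -- The derivative of the pulled-back error carries `h / 2`, and integration over `[-1,1]`
  -- contributes `2`. This factor `h` is what closes the estimate.
  have hE : ∀ i, CkBound K (η + h * (c1 * Z + c2 * W))
      (fun x => (u (affineMap a b x) - p (affineMap a b x)) i) := by
    intro i
    have hder : ∀ x ∈ Icc (-1 : ℝ) 1, HasDerivWithinAt
        (fun x => (u (affineMap a b x) - p (affineMap a b x)) i)
        ((h / 2) • (f (affineMap a b x) (u (affineMap a b x)) i - (P i).eval x)) (Icc (-1) 1) x := by
      intro x hx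
      have hx' := affineMap_mem hab hx
      have e1 := ((hu.2 _ (hsub hx')).mono hsub).sub
        ((hp.poly.contDiff.differentiable one_ne_zero (affineMap a b x)).hasDerivAt.hasDerivWithinAt
          (s := Icc a b))
      have e2 := (EuclideanSpace.proj i : Vec d →L[ℝ] ℝ).hasFDerivAt.comp_hasDerivWithinAt _ e1
      have e3 := HasDerivWithinAt.comp_affineMap hab e2
      rw [hhe, ← hPe]
      exact e3
    refine ((CkBound.integrate hder ((hD i).const_smul (h / 2)) (A := η) ?_).of_le
      (Nat.le_succ K)).weaken (le_of_eq ?_)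
    · rw [affineMap_neg_one, hηe]; exact PiLp.norm_apply_le _ i
    · rw [abs_of_pos (by linarith)]; ring
  have hF := hfd a b ha hab hb (by linarith) u p _ huK hpC (CkBound.of_apply hE)
  -- Splitting `f(p) - q = -(f(u) - f(p)) + (f(u) - q)`.
  have hG : ∀ i, CkBound K (c3 * (d * (η + h * (c1 * Z + c2 * W))) + c1 * Z)
      (fun x => f (affineMap a b x) (p (affineMap a b x)) i - (q i).eval x) := fun i =>
    (((hF.apply i).const_smul (-1)).add (hq i)).congr (fun x _ => by simp) |>.weaken (by simp)
  have hgC : ∀ i, ContDiffOn ℝ (max kA kI : ℕ)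
      (fun x => f (affineMap a b x) (p (affineMap a b x)) i) (Icc (-1) 1) := fun i =>
    ((EuclideanSpace.proj i : Vec d →L[ℝ] ℝ).contDiff.comp_contDiffOn
      (hfp.comp_affineMap hab)).of_le (by exact_mod_cast hAI)
  have hqA : ∀ i, ∀ ψ ∈ degreeLT ℝ (r - k + 1), Q (fun x => (P i - q i).eval x * ψ.eval x)
      = Q (fun x => (P i).eval x * ψ.eval x)
        - Q (fun x => A (fun y => (q i).eval y) x * ψ.eval x) := by
    intro i ψ hψ
    rw [← hrA _ (hqm i) ψ hψ, ← hQ.sub ((contDiffOn_eval _ _ _).mul (contDiffOn_eval _ _ _))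
      ((contDiffOn_eval _ _ _).mul (contDiffOn_eval _ _ _))]
    congr 1; funext x; rw [eval_sub]; ring
  have hbd : ∀ (i : Fin d) (j : ℕ) (x : ℝ), j ≤ K → x ∈ Icc (-1 : ℝ) 1 →
      (derivative^[j] (P i)).eval x = iteratedDerivWithin j
        (fun x => f (affineMap a b x) (p (affineMap a b x)) i) (Icc (-1) 1) x →
      (derivative^[j] (P i - q i)).eval x = iteratedDerivWithin j
        (fun x => f (affineMap a b x) (p (affineMap a b x)) i - (q i).eval x) (Icc (-1) 1) x := by
    intro i j x hj hx he
    have e := iteratedDerivWithin_sub (n := j) hx uniqueDiffOn_ref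
      (((EuclideanSpace.proj i : Vec d →L[ℝ] ℝ).contDiff.comp_contDiffOn
        (hfp.comp_affineMap hab)).of_le (m := (j : WithTop ℕ∞)) (by exact_mod_cast hj) x hx)
      (contDiffOn_eval j (q i) _ x hx)
    rw [iteratedDerivWithin_eval j (q i) uniqueDiffOn_ref hx] at e
    rw [iterate_derivative_sub, eval_sub, he]
    exact e.symm
  -- The bound of `R` contains `W`, the sum of these very norms; the inequality is resolved right
  -- after by `local_bound_arith`.
  have hstab' : ∀ i, coeffNorm r (P i - q i)
      ≤ c4 * (c3 * (d * (η + h * (c1 * Z + c2 * W))) + c1 * Z) := by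
    intro i
    refine hstab _ (hRr i) _ _ (hG i) (fun j hj => hbd i j 1 (by omega) (by simp) (hPright i j hj))
      (fun j hj => hbd i j (-1) (by omega) (by simp) (hPleft i j hj)) fun ψ hψ hk0 => ?_
    rw [int_approx_sub hQ hA (hgC i), hqA i ψ hψ]
    congr 1
    have e := hPvar i ψ hψ
    have e0 : (p a i - Ua i) * ψ.eval (-1) = 0 := by
      rcases Nat.eq_zero_or_pos k with hk | hk
      · rw [hk0 hk, mul_zero]
      · rw [hp.initial hk, sub_self, zero_mul]
    rw [e0, add_zero] at e
    exact mul_left_cancel₀ (by linarith : (b - a) / 2 ≠ 0) e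
  obtain ⟨hWb, hEb⟩ := local_bound_arith hd0 hc1 hc2 hc3 hc4 hh0 hh1 hZ0 hη0 hW0 hα hβ hc5e hc6e
    hs1 (by
      rw [hWe]
      refine (Finset.sum_le_card_nsmul _ _ _ fun i _ => hstab' i).trans (le_of_eq ?_)
      simp [hWe])
  have hhZ : h * Z ≤ Z := mul_le_of_le_one_left hZ0 hh1
  -- Testing with `1` brings the jump back: it is `h / 2` times the defect of the tested equation
  -- for `R`, whose two terms are by now bounded.
  have hjump : ‖p a - Ua‖ ≤ c7 * (h * (η + Z)) := by
    rw [hc7e, mul_assoc]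
    refine norm_le_card_mul fun i => ?_
    have h1m : (1 : ℝ[X]) ∈ degreeLT ℝ (r - k + 1) := mem_degreeLT.2
      (degree_one_le.trans_lt (by exact_mod_cast Nat.succ_pos _))
    have e1 := int_approx_sub hQ hA (hgC i) (q i) 1
    have e2 := hqA i 1 h1m
    have e3 := hPvar i 1 h1m
    simp only [eval_one, mul_one] at e1 e2 e3
    have e4 : (p a - Ua) i = h / 2 * (Q (A fun y => f (affineMap a b y) (p (affineMap a b y)) i
        - (q i).eval y) - Q (fun x => (P i - q i).eval x)) := by
      rw [e1, e2, hhe]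
      simp only [PiLp.sub_apply]
      linarith
    have e5 := hCQ _ _ (hCA _ _ ((hG i).of_le hAI))
    have e6 := hCQ _ _ ((hR i).of_le ((le_max_right _ _).trans hAI))
    have e7 : c3 * (d * (η + h * (c1 * Z + c2 * W))) + c1 * Z
        ≤ (c3 * (d * c6) + c1) * (η + Z) := by
      have g1 : c3 * (d * (η + h * (c1 * Z + c2 * W))) ≤ c3 * (d * (c6 * (η + h * Z))) := by gcongr
      have g2 : c3 * (d * (c6 * (η + h * Z))) ≤ c3 * (d * (c6 * (η + Z))) := by gcongr
      have g3 : 0 ≤ c1 * η := by positivity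
      linarith
    have e8 : CQ * (CA * (c3 * (d * (η + h * (c1 * Z + c2 * W))) + c1 * Z))
        ≤ CQ * (CA * ((c3 * (d * c6) + c1) * (η + Z))) := by gcongr
    have e9 : CQ * (c2 * W) ≤ CQ * (c2 * (c5 * (η + Z))) := by gcongr
    rw [e4]
    refine (abs_half_mul_sub_le hh0.le (e5.trans e8) (e6.trans e9)).trans (le_of_eq ?_)
    ring
  have hηε : η ≤ ε + c7 * (h * (η + Z)) := by
    have e : η ≤ ε + ‖p a - Ua‖ := by
      rw [hηe, hεe, norm_sub_rev (p a)]
      exact (norm_sub_le_norm_sub_add_norm_sub (u a) Ua (p a))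
    linarith
  obtain ⟨hC1, hC2, hC3⟩ := local_bound_arith_final (a6 := c3 * (d * c6)) (a5 := c2 * c5) (c1 := c1)
    (by positivity) (by positivity) hc1 hc7 hh0 hZ0 hη0 hε0 hs2 hηε
  refine ⟨hjump.trans hC1, hF.weaken (le_trans ?_ hC2), fun i =>
    ((hD i).congr fun x _ => by rw [hPe]).weaken (le_trans ?_ hC3)⟩
  · rw [mul_assoc, mul_assoc]
    gcongr
  · rw [mul_assoc]
    gcongr

/-- The error on one interval. -/
theorem exists_local_error {d r k kI kA : ℕ} (hkr : k ≤ r) (i₀ : Fin d)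
    {Q : (ℝ → ℝ) → ℝ} (hQ : IsRefIntegrator kI Q)
    {A : (ℝ → ℝ) → ℝ → ℝ} (hA : IsRefApproximation kA A)
    {t₀ T : ℝ} (hT : 0 < T) {f : ℝ → Vec d → Vec d} {u₀ : Vec d} {u : ℝ → Vec d}
    (hf : ContDiffOn ℝ (max (kJ k kI kA) (r + 1) : ℕ) (fun z : ℝ × Vec d => f z.1 z.2)
      (Icc t₀ (t₀ + T) ×ˢ univ))
    (hu : IsIVPSolution t₀ T f u₀ u) (hInt : AssIntegrator r k Q) (hSupInt : AssSupIntegrator d kI Q)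
    (hSup : AssSupApprox d kI kA A) (hDiff : AssDiff (kJ k kI kA) t₀ T f)
    {m : ℕ} (hm : m ≤ r)
    (hrA : ∀ q ∈ degreeLT ℝ m, ∀ ψ ∈ degreeLT ℝ (r - k + 1),
      Q (fun x => q.eval x * ψ.eval x) = Q (fun x => A (fun y => q.eval y) x * ψ.eval x)) :
    ∃ C, 0 ≤ C ∧ ∃ h₀ > 0, h₀ ≤ 1 ∧ ∀ a b : ℝ, t₀ ≤ a → a < b → b ≤ t₀ + T → b - a ≤ h₀ →
      ∀ (Ua : Vec d) (p : ℝ → Vec d), IsLocalSolution r k Q A f a b Ua p →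
        (∀ t ∈ Icc a b, ‖u t - p t‖ ≤ C * (‖u a - Ua‖ + (b - a) ^ (m + 1))) ∧
        (∀ t ∈ Icc a b, ‖f t (u t) - deriv p t‖ ≤ C * (‖u a - Ua‖ + (b - a) ^ m)) ∧
        ‖u b - p b‖ ≤ ‖u a - Ua‖ + C * (b - a) * (‖u a - Ua‖ + (b - a) ^ m) ∧
        ((∀ q ∈ degreeLT ℝ r, ∫ x in (-1 : ℝ)..1, q.eval x = Q (fun x => q.eval x)) →
          (∀ q ∈ degreeLT ℝ (m + 1), ∫ x in (-1 : ℝ)..1, q.eval x = Q (fun x => q.eval x)) →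
          (∀ q ∈ degreeLT ℝ (m + 1), Q (fun x => q.eval x) = Q (A fun x => q.eval x)) →
          ‖u b - p b‖ ≤ ‖u a - Ua‖ + C * (b - a) * (‖u a - Ua‖ + (b - a) ^ (m + 1))) := by
  obtain ⟨C₀, hC₀, h₀, hh₀, hh₀1, hloc⟩ :=
    exists_local_bound hkr i₀ hQ hA hT hf hu hInt hSupInt hSup hDiff hm hrA
  set K := kJ k kI kA with hK
  have hkK : k / 2 - 1 ≤ K := le_max_left _ _
  have hAI : max kA kI ≤ K := by rw [hK, kJ, max_comm kA kI]; exact le_max_right _ _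
  have hfK := hf.of_le (m := (K : WithTop ℕ∞)) (by exact_mod_cast le_max_left K (r + 1))
  have huC := hu.contDiffOn hT hf
  obtain ⟨CQ, hCQ0, hCQ⟩ := hSupInt.exists_bound i₀
  obtain ⟨CA, hCA0, hCA⟩ := hA.exists_bound hSup i₀
  obtain ⟨c1, hc1, htay⟩ := exists_local_taylor hT (contDiffOn_comp_field hf huC)
  obtain ⟨c8, hc8e⟩ : ∃ c8, c8 = 2 * c1 + CQ * (CA * (C₀ + c1)) := ⟨_, rfl⟩
  have hc8 : 0 ≤ c8 := by rw [hc8e]; positivity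
  have hd0 : (0 : ℝ) ≤ d := Nat.cast_nonneg d
  refine ⟨1 + (d + 1) * C₀ + d * c8, by positivity, h₀, hh₀, hh₀1, fun a b ha hab hb hh Ua p hp => ?_⟩
  obtain ⟨hjump, hF, hG⟩ := hloc a b ha hab hb hh Ua p hp
  have hsub : Icc a b ⊆ Icc t₀ (t₀ + T) := Icc_subset_Icc ha hb
  obtain ⟨h, hhe⟩ : ∃ h, h = b - a := ⟨_, rfl⟩
  obtain ⟨Z, hZe⟩ : ∃ Z, Z = (b - a) ^ m := ⟨_, rfl⟩
  obtain ⟨ε, hεe⟩ : ∃ ε, ε = ‖u a - Ua‖ := ⟨_, rfl⟩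
  rw [pow_succ']
  rw [← hεe, ← hZe] at hG ⊢
  rw [← hεe, ← hZe, ← hhe] at hjump hF
  rw [← hhe]
  have hh0 : 0 < h := by linarith
  have hh1 : h ≤ 1 := by linarith
  have hZ0 : 0 ≤ Z := by rw [hZe, ← hhe]; positivity
  have hε0 : 0 ≤ ε := by rw [hεe]; positivity
  have hrhs : ∀ x ∈ Icc (-1 : ℝ) 1, ‖f (affineMap a b x) (u (affineMap a b x))
      - deriv p (affineMap a b x)‖ ≤ d * (C₀ * (ε + Z)) := fun x hx =>
    norm_le_card_mul fun i => (hG i).norm_le hx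
  have hder : ∀ x ∈ Icc (-1 : ℝ) 1, HasDerivWithinAt
      (fun x => u (affineMap a b x) - p (affineMap a b x))
      ((h / 2) • (f (affineMap a b x) (u (affineMap a b x)) - deriv p (affineMap a b x)))
      (Icc (-1) 1) x := by
    intro x hx
    have hx' := affineMap_mem hab hx
    rw [hhe]
    exact HasDerivWithinAt.comp_affineMap (g := fun t => u t - p t) hab
      (((hu.2 _ (hsub hx')).mono hsub).sub
        ((hp.poly.contDiff.differentiable one_ne_zero (affineMap a b x)).hasDerivAt.hasDerivWithinAt
          (s := Icc a b)))
  have hinit : ‖u a - p a‖ ≤ ε + C₀ * (h * (ε + Z)) := by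
    have e : ‖u a - p a‖ ≤ ‖u a - Ua‖ + ‖p a - Ua‖ := by
      rw [norm_sub_rev (p a)]
      exact norm_sub_le_norm_sub_add_norm_sub (u a) Ua (p a)
    linarith
  -- Mean value inequality; in `d + 1` the `d` comes from the components of the derivative and the
  -- `1` from the jump.
  have hE : ∀ x ∈ Icc (-1 : ℝ) 1, ‖u (affineMap a b x) - p (affineMap a b x)‖
      ≤ ε + (d + 1) * C₀ * (h * (ε + Z)) := by
    intro x hx
    have e1 := (convex_Icc (-1 : ℝ) 1).norm_image_sub_le_of_norm_hasDerivWithin_le hder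
      (C := h / 2 * (d * (C₀ * (ε + Z)))) (fun y hy => by
        rw [norm_smul, Real.norm_eq_abs, abs_of_pos (by linarith)]
        exact mul_le_mul_of_nonneg_left (hrhs y hy) (by linarith))
      (left_mem_Icc.2 (by norm_num)) hx
    have e2 : ‖x - -1‖ ≤ 2 := by
      rw [Real.norm_eq_abs, abs_le]; constructor <;> linarith [hx.1, hx.2]
    have e3 := e1.trans (mul_le_mul_of_nonneg_left e2 (by positivity))
    rw [affineMap_neg_one] at e3
    have e4 := norm_le_norm_add_norm_sub' (u (affineMap a b x) - p (affineMap a b x)) (u a - p a)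
    linarith
  have hY : 0 ≤ h * (ε + Z) := by positivity
  have hY1 : 0 ≤ ε + h * Z := by positivity
  have hY2 : 0 ≤ ε + Z := by positivity
  have hdC : 0 ≤ (d : ℝ) * C₀ := by positivity
  have hdc : 0 ≤ (d : ℝ) * c8 := by positivity
  refine ⟨fun t ht => ?_, fun t ht => ?_, ?_, fun hEx1 hEx2 hI0 => ?_⟩
  · have e := hE _ (affineInv_mem hab ht)
    rw [affineMap_affineInv hab] at e
    have e1 : h * (ε + Z) ≤ ε + h * Z := by
      have := mul_le_of_le_one_left hε0 hh1
      linarith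
    have e2 : (d + 1) * C₀ * (h * (ε + Z)) ≤ (d + 1) * C₀ * (ε + h * Z) := by gcongr
    have := mul_nonneg hdc hY1
    have : 0 ≤ h * Z := by positivity
    linarith
  · have e := hrhs _ (affineInv_mem hab ht)
    rw [affineMap_affineInv hab] at e
    have := mul_nonneg hdc hY2
    have := mul_nonneg hC₀ hY2
    linarith
  · have e := hE 1 (by simp)
    rw [affineMap_one] at e
    have := mul_nonneg hdc hY
    linarith
  -- The fundamental theorem and exactness on `P` turn `∫ p'` into `Q[p']`, and the equation tested
  -- with `1` trades this and the jump for `Q[A f(p)]`. So no bound of `P - q` is needed, only those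
  -- of `f(u) - q` and `f(p) - q`.
  · have hcomp : ∀ i, |(u b - p b - (u a - Ua)) i| ≤ h * (c8 * (ε + h * Z)) := by
      intro i
      have hfp : ContDiffOn ℝ K (fun t => f t (p t)) (Icc a b) :=
        (contDiffOn_comp_field hfK hp.poly.contDiff.contDiffOn).mono hsub
      obtain ⟨P, hPr, hPe, -, -, hPvar⟩ := hp.reference hab hfp hkK i
      -- One degree more than in the stability argument; since `m + 1 ≤ r + 1`, the class `C^{r+1}`
      -- of `f` is used up here.
      obtain ⟨q, hqm, hq⟩ := htay a b ha hab hb (by linarith) (m + 1) (by omega) i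
      rw [pow_succ', ← hZe, ← hhe] at hq
      have hG' : CkBound K (C₀ * (ε + h * Z) + c1 * (h * Z))
          (fun x => f (affineMap a b x) (p (affineMap a b x)) i - q.eval x) :=
        (((hF.apply i).const_smul (-1)).add hq).congr (fun x _ => by simp) |>.weaken (by simp)
      have hgC : ContDiffOn ℝ (max kA kI : ℕ)
          (fun x => f (affineMap a b x) (p (affineMap a b x)) i) (Icc (-1) 1) :=
        ((EuclideanSpace.proj i : Vec d →L[ℝ] ℝ).contDiff.comp_contDiffOn
          (hfp.comp_affineMap hab)).of_le (by exact_mod_cast hAI)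
      have e1 := int_approx_sub hQ hA hgC q 1
      have e2 := hPvar 1 (mem_degreeLT.2
        (degree_one_le.trans_lt (by exact_mod_cast Nat.succ_pos _)))
      simp only [eval_one, mul_one] at e1 e2
      have hdi : ∀ x ∈ Icc (-1 : ℝ) 1, HasDerivWithinAt
          (fun x => (u (affineMap a b x) - p (affineMap a b x)) i)
          ((h / 2) * (f (affineMap a b x) (u (affineMap a b x)) i - P.eval x)) (Icc (-1) 1) x := by
        intro x hx
        have := (EuclideanSpace.proj i : Vec d →L[ℝ] ℝ).hasFDerivAt.comp_hasDerivWithinAt _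
          (hder x hx)
        rw [← hPe]
        exact this
      have hqc : ∀ s : ℝ[X], ContinuousOn (fun x => s.eval x) (Icc (-1) 1) := fun s =>
        s.continuous.continuousOn
      have hWc : ContinuousOn (fun x => f (affineMap a b x) (u (affineMap a b x)) i)
          (Icc (-1) 1) := by
        have := hq.smooth.continuousOn.add (hqc q)
        exact this.congr fun x _ => by simp
      have hint : ∀ {φ : ℝ → ℝ}, ContinuousOn φ (Icc (-1) 1) →
          IntervalIntegrable φ volume (-1) 1 := fun hφ =>
        ContinuousOn.intervalIntegrable (by rwa [uIcc_of_le (by norm_num)])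
      have hftc := intervalIntegral.integral_eq_sub_of_hasDerivAt_of_le (a := -1) (b := 1)
        (by norm_num) (fun x hx => (hdi x hx).continuousWithinAt)
        (fun x hx => (hdi x (Ioo_subset_Icc_self hx)).hasDerivAt (Icc_mem_nhds hx.1 hx.2))
        (hint (continuousOn_const.mul (hWc.sub (hqc P))))
      rw [intervalIntegral.integral_const_mul, intervalIntegral.integral_sub (hint hWc)
        (hint (hqc P)), hEx1 P hPr, affineMap_one, affineMap_neg_one] at hftc
      -- By the exactness hypotheses `∫ q = Q[q] = Q[A q]`, so `q` can be inserted in both terms of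
      -- the defect.
      have e3 : ∫ x in (-1 : ℝ)..1, (f (affineMap a b x) (u (affineMap a b x)) i - q.eval x)
          = (∫ x in (-1 : ℝ)..1, f (affineMap a b x) (u (affineMap a b x)) i)
            - Q (A fun x => q.eval x) := by
        rw [intervalIntegral.integral_sub (hint hWc) (hint (hqc q)), hEx2 q hqm, hI0 q hqm]
      have e4 : (u b - p b - (u a - Ua)) i
          = h / 2 * ((∫ x in (-1 : ℝ)..1, (f (affineMap a b x) (u (affineMap a b x)) i - q.eval x))
            - Q (A fun x => f (affineMap a b x) (p (affineMap a b x)) i - q.eval x)) := by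
        rw [e3, e1]
        simp only [PiLp.sub_apply] at hftc ⊢
        rw [← hhe] at e2
        linarith
      have e5 : |∫ x in (-1 : ℝ)..1, (f (affineMap a b x) (u (affineMap a b x)) i - q.eval x)|
          ≤ 2 * (c1 * (h * Z)) := by
        rw [← Real.norm_eq_abs]
        refine (intervalIntegral.norm_integral_le_of_norm_le_const (C := c1 * (h * Z))
          fun x hx => ?_).trans (le_of_eq ?_)
        · rw [uIoc_of_le (by norm_num)] at hx
          exact hq.norm_le (Ioc_subset_Icc_self hx)
        · norm_num [mul_comm]
      have e6 := hCQ _ _ (hCA _ _ (hG'.of_le hAI))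
      rw [e4]
      refine (abs_half_mul_sub_le hh0.le e5 e6).trans (mul_le_mul_of_nonneg_left ?_ hh0.le)
      rw [hc8e]
      have g1 : 0 ≤ c1 * ε := by positivity
      have g2 : 0 ≤ CQ * (CA * (c1 * ε)) := by positivity
      linarith
    have e7 := norm_le_card_mul hcomp
    have e8 := norm_le_norm_add_norm_sub' (u b - p b) (u a - Ua)
    have g1 : 0 ≤ h * (ε + h * Z) := by positivity
    have g2 := mul_nonneg hdC g1
    have g3 := mul_nonneg hC₀ g1
    linarith

/-! ### Accumulation of the local errors -/

/-- With `σ` added the recursion becomes purely multiplicative, `E (n+1) + σ ≤ (1 + C h) (E n + σ)`,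
and the factors are bounded by exponentials whose exponents telescope. -/
theorem mesh_gronwall {N : ℕ} {t E : ℕ → ℝ} {C σ : ℝ} (hC : 0 ≤ C) (hσ : 0 ≤ σ)
    (ht : ∀ n < N, t n ≤ t (n + 1)) (hE0 : ∀ n, 0 ≤ E n) (h0 : E 0 = 0)
    (h : ∀ n < N, E (n + 1) ≤ E n + C * (t (n + 1) - t n) * (E n + σ)) :
    ∀ n ≤ N, E n ≤ Real.exp (C * (t n - t 0)) * σ := by
  suffices H : ∀ n ≤ N, E n + σ ≤ Real.exp (C * (t n - t 0)) * σ from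
    fun n hn => by linarith [H n hn]
  intro n
  induction n with
  | zero => intro _; simp [h0]
  | succ n ih =>
    intro hn
    have h1 := ih (by omega)
    have h2 := h n (by omega)
    have h3 : 1 + C * (t (n + 1) - t n) ≤ Real.exp (C * (t (n + 1) - t n)) := by
      linarith [Real.add_one_le_exp (C * (t (n + 1) - t n))]
    have h4 : 0 ≤ C * (t (n + 1) - t n) := mul_nonneg hC (by linarith [ht n (by omega)])
    calc E (n + 1) + σ ≤ (1 + C * (t (n + 1) - t n)) * (E n + σ) := by linarith
      _ ≤ Real.exp (C * (t (n + 1) - t n)) * (Real.exp (C * (t n - t 0)) * σ) :=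
        mul_le_mul h3 h1 (add_nonneg (hE0 n) hσ) (Real.exp_nonneg _)
      _ = Real.exp (C * (t (n + 1) - t 0)) * σ := by
        rw [← mul_assoc, ← Real.exp_add]; congr 2; ring

theorem IsMesh.mono {t₀ T : ℝ} {N : ℕ} {t : ℕ → ℝ} (ht : IsMesh t₀ T N t) {n l : ℕ} (hnl : n ≤ l)
    (hl : l ≤ N) : t n ≤ t l := by
  induction l, hnl using Nat.le_induction with
  | base => exact le_rfl
  | succ l hnl ih => exact (ih (by omega)).trans (ht.2.2 l (by omega)).le

theorem le_meshSize {N : ℕ} (t : ℕ → ℝ) {n : ℕ} (hn : n < N) : t (n + 1) - t n ≤ meshSize N t :=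
  le_ciSup (f := fun n : Fin N => t (n + 1) - t n) (Set.finite_range _).bddAbove ⟨n, hn⟩

/-! ### Approximation orders -/

/-- `x` is the largest degree plus one, so `P_{-1}` corresponds to `0`. The spaces are nested, so
the property holds at every finite `n ≤ x`, also if `x = ⊤`. -/
theorem largestDegree_spec {H : ℝ[X] → Prop} (h0 : H 0) :
    ∃ x : ℕ∞, largestDegree H = ENat.map (fun n : ℕ => (n : ℤ) - 1) x ∧
      ∀ n : ℕ, (n : ℕ∞) ≤ x → ∀ p ∈ degreeLT ℝ n, H p := by
  refine ⟨_, rfl, fun n hn p hp => ?_⟩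
  rcases n with _ | n
  · obtain rfl : p = 0 := by simpa [mem_degreeLT, WithBot.lt_coe_bot] using hp
    exact h0
  · have h1 : (n : ℕ∞) < ⨆ (l : ℕ) (_ : ∀ p ∈ degreeLT ℝ l, H p), (l : ℕ∞) :=
      lt_of_lt_of_le (by exact_mod_cast Nat.lt_succ_self n) hn
    simp only [lt_iSup_iff] at h1
    obtain ⟨l, hl, hnl⟩ := h1
    exact hl p (degreeLT_mono (by exact_mod_cast hnl) hp)

/-- The basic order `m` is an integer, and the improved order is at most `m` or equal to `m + 1`. -/
theorem order_arith (r : ℕ) (x y z : ℕ∞) (X Y Z : WithTop ℤ)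
    (hX : X = ENat.map (fun n : ℕ => (n : ℤ) - 1) x)
    (hY : Y = ENat.map (fun n : ℕ => (n : ℤ) - 1) y)
    (hZ : Z = ENat.map (fun n : ℕ => (n : ℤ) - 1) z) :
    ∃ m : ℕ, m ≤ r ∧ (m : ℕ∞) ≤ x ∧ min ((r : ℤ) : WithTop ℤ) (X + 1) = ((m : ℤ) : WithTop ℤ) ∧
      ∃ s : ℤ, min (((r : ℤ) + 1 : ℤ) : WithTop ℤ) (min (X + 2) (min (Y + 1)
          (max (Z + 1) (min ((r : ℤ) : WithTop ℤ) (X + 1))))) = (s : WithTop ℤ) ∧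
        ((((r : ℤ) - 1 : ℤ) : WithTop ℤ) ≤ max Z (X + 1) → s ≤ m ∨
          (s = m + 1 ∧ ((m + 1 : ℕ) : ℕ∞) ≤ y ∧ ((m + 1 : ℕ) : ℕ∞) ≤ z ∧ (r : ℕ∞) ≤ z)) := by
  have h1 : (1 : WithTop ℤ) = ((1 : ℤ) : WithTop ℤ) := rfl
  have h2 : (2 : WithTop ℤ) = ((2 : ℤ) : WithTop ℤ) := rfl
  -- As `X + 1` corresponds to `x`, the number `m` is `min r x`; the minimum with `r` keeps it
  -- finite.
  have key : ∃ m : ℕ, m ≤ r ∧ (m : ℕ∞) ≤ x ∧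
      min ((r : ℤ) : WithTop ℤ) (X + 1) = ((m : ℤ) : WithTop ℤ) ∧
      min (((r : ℤ) + 1 : ℤ) : WithTop ℤ) (X + 2) = ((m + 1 : ℤ) : WithTop ℤ) := by
    subst hX
    induction x using ENat.recTopCoe with
    | top => exact ⟨r, le_rfl, le_top, by simp, by simp⟩
    | coe x =>
      refine ⟨min r x, min_le_left _ _, by simp, ?_, ?_⟩ <;>
      simp only [ENat.map_natCast, h1, h2, ← WithTop.coe_add, ← WithTop.coe_min, WithTop.coe_inj] <;>
      omega
  obtain ⟨m, hmr, hmx, hm, hm1⟩ := key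
  refine ⟨m, hmr, hmx, hm, ?_⟩
  rw [hm, ← min_assoc, hm1]
  -- Cutting `X + 1` off at `r` loses nothing in a comparison with `r - 1`. Hence either `z ≥ r` or
  -- `m ≥ r - 1`, and in the latter case `z ≥ m + 1` also gives `z ≥ r`.
  have hr : (((r : ℤ) - 1 : ℤ) : WithTop ℤ) ≤ max Z (X + 1) →
      (((r : ℤ) - 1 : ℤ) : WithTop ℤ) ≤ max Z ((m : ℤ) : WithTop ℤ) := by
    intro h
    rw [← hm]
    rcases le_max_iff.1 h with h | h
    · exact le_max_of_le_left h
    · exact le_max_of_le_right (le_min (WithTop.coe_le_coe.2 (by omega)) h)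
  subst hY hZ
  induction y using ENat.recTopCoe with
  | top =>
    induction z using ENat.recTopCoe with
    | top => exact ⟨m + 1, by simp, fun _ => Or.inr ⟨rfl, le_top, le_top, le_top⟩⟩
    | coe z =>
      simp only [ENat.map_natCast, ENat.map_top, h1, WithTop.top_add, ← WithTop.coe_add,
        ← WithTop.coe_min, ← WithTop.coe_max, WithTop.coe_inj, WithTop.coe_le_coe, le_top,
        inf_of_le_right] at hr ⊢
      refine ⟨_, rfl, fun h => ?_⟩
      have := hr h
      simp only [Nat.cast_le, true_and]
      omega
  | coe y =>
    induction z using ENat.recTopCoe with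
    | top =>
      simp only [ENat.map_natCast, ENat.map_top, h1, WithTop.top_add, ← WithTop.coe_add,
        ← WithTop.coe_min, max_eq_left, min_eq_left, le_top]
      refine ⟨_, rfl, fun h => ?_⟩
      rcases le_or_gt (m + 1) y with hy | hy
      · exact Or.inr ⟨by omega, by exact_mod_cast hy, by simp, by simp⟩
      · exact Or.inl (by omega)
    | coe z =>
      simp only [ENat.map_natCast, h1, ← WithTop.coe_add,
        ← WithTop.coe_min, ← WithTop.coe_max, WithTop.coe_le_coe] at hr ⊢
      refine ⟨_, rfl, fun h => ?_⟩
      have := hr h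
      simp only [Nat.cast_le]
      omega

theorem localInt_ref (Q : (ℝ → ℝ) → ℝ) (φ : ℝ → ℝ) : localInt Q (-1) 1 φ = Q φ := by
  simp [localInt, affineMap]

theorem localApprox_ref (A : (ℝ → ℝ) → ℝ → ℝ) (φ : ℝ → ℝ) : localApprox A (-1) 1 φ = A φ := by
  funext t
  simp only [localApprox, show affineInv (-1) 1 t = t by unfold affineInv; ring]
  congr 1
  funext x
  simp [affineMap]

theorem IsRefIntegrator.map_eq_zero {kI : ℕ} {Q : (ℝ → ℝ) → ℝ} (hQ : IsRefIntegrator kI Q)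
    {φ : ℝ → ℝ} (hφ : EqOn φ 0 (Icc (-1) 1)) : Q φ = 0 := by
  have h0 : ContDiffOn ℝ kI (fun _ : ℝ => (0 : ℝ)) (Icc (-1) 1) := contDiffOn_const
  rw [hQ.congr φ (fun _ => 0) (h0.congr hφ) hφ]
  simpa using hQ.smul 0 _ h0

theorem IsRefApproximation.map_zero {kA : ℕ} {A : (ℝ → ℝ) → ℝ → ℝ} (hA : IsRefApproximation kA A) :
    EqOn (A fun _ => 0) 0 (Icc (-1) 1) := fun x hx => by
  simpa using hA.smul 0 (fun _ => (0 : ℝ)) contDiffOn_const hx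

theorem rEx_spec {kI : ℕ} {Q : (ℝ → ℝ) → ℝ} (hQ : IsRefIntegrator kI Q) :
    ∃ x : ℕ∞, rEx Q = ENat.map (fun n : ℕ => (n : ℤ) - 1) x ∧ ∀ n : ℕ, (n : ℕ∞) ≤ x →
      ∀ q ∈ degreeLT ℝ n, ∫ x in (-1 : ℝ)..1, q.eval x = Q (fun x => q.eval x) := by
  obtain ⟨x, hx, h⟩ := largestDegree_spec (H := fun p => ∀ a b : ℝ, a < b →
    ∫ t in a..b, p.eval t = localInt Q a b (fun t => p.eval t)) fun a b _ => by
      simp [localInt, hQ.map_eq_zero (φ := fun _ => 0) fun _ _ => rfl]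
  refine ⟨x, hx, fun n hn q hq => ?_⟩
  rw [h n hn q hq (-1) 1 (by norm_num), localInt_ref]

theorem rIA_spec {kI kA : ℕ} {Q : (ℝ → ℝ) → ℝ} (hQ : IsRefIntegrator kI Q)
    {A : (ℝ → ℝ) → ℝ → ℝ} (hA : IsRefApproximation kA A) (i : ℕ) :
    ∃ x : ℕ∞, rIA Q A i = ENat.map (fun n : ℕ => (n : ℤ) - 1) x ∧ ∀ n : ℕ, (n : ℕ∞) ≤ x →
      ∀ q ∈ degreeLT ℝ n, ∀ ψ ∈ degreeLT ℝ (i + 1),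
        Q (fun x => q.eval x * ψ.eval x) = Q (fun x => A (fun y => q.eval y) x * ψ.eval x) := by
  obtain ⟨x, hx, h⟩ := largestDegree_spec (H := fun p => ∀ a b : ℝ, a < b →
    ∀ ψ ∈ degreeLT ℝ (i + 1), localInt Q a b (fun t => p.eval t * ψ.eval t)
      = localInt Q a b (fun t => localApprox A a b (fun s => p.eval s) t * ψ.eval t))
    fun a b hab ψ _ => by
      unfold localInt
      congr 1
      rw [hQ.map_eq_zero fun x _ => by simp, hQ.map_eq_zero fun x hx => ?_]
      have := hA.map_zero hx
      simp_all [localApprox, affineInv_affineMap hab]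
  refine ⟨x, hx, fun n hn q hq ψ hψ => ?_⟩
  have := h n hn q hq (-1) 1 (by norm_num) ψ hψ
  rwa [localInt_ref, localInt_ref, localApprox_ref] at this

/-! ### The error estimate -/

theorem mainTheorem1 (d r k kI kA : ℕ) (hkr : k ≤ r)
    (Q : (ℝ → ℝ) → ℝ) (hQ : IsRefIntegrator kI Q)
    (A : (ℝ → ℝ) → ℝ → ℝ) (hA : IsRefApproximation kA A)
    (t₀ T : ℝ) (hT : 0 < T) (f : ℝ → Vec d → Vec d) (u₀ : Vec d) (u : ℝ → Vec d)
    (hf : ContDiffOn ℝ (max (kJ k kI kA) (r + 1) : ℕ) (fun z : ℝ × Vec d => f z.1 z.2)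
      (Icc t₀ (t₀ + T) ×ˢ univ))
    (hLip : ∃ L : NNReal, ∀ t ∈ Icc t₀ (t₀ + T), LipschitzWith L (f t))
    (hu : IsIVPSolution t₀ T f u₀ u)
    (hInt : AssIntegrator r k Q)
    (hSupInt : AssSupIntegrator d kI Q)
    (hSup : AssSupApprox d kI kA A)
    (hDiff : AssDiff (kJ k kI kA) t₀ T f)
    (hPoint : AssPointA d kI kA A ∨ AssPointB d kI kA Q A) :
    ∃ τ₀ > 0, ∃ C > 0, ∀ (N : ℕ) (t : ℕ → ℝ), IsMesh t₀ T N t → meshSize N t ≤ τ₀ →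
      ∀ U : ℝ → Vec d, IsDiscreteSolution r k Q A f u₀ N t U → ∀ n < N,
        DifferentiableOn ℝ (fun s => u s - U s) (Ioc (t n) (t (n + 1))) ∧
        (∀ s ∈ Ioc (t n) (t (n + 1)),
          ‖u s - U s‖ ≤ C * meshSize N t ^ (basicOrder r k Q A).untopD 0 ∧
          ‖derivWithin (fun s => u s - U s) (Ioc (t n) (t (n + 1))) s‖
            ≤ C * meshSize N t ^ (basicOrder r k Q A).untopD 0) ∧
        ((((r : ℤ) - 1 : ℤ) : WithTop ℤ) ≤ max (rEx Q) (rIA Q A (r - k) + 1) →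
          ∀ s ∈ Ioc (t n) (t (n + 1)),
            ‖u s - U s‖ ≤ C * meshSize N t ^ (improvedOrder r k Q A).untopD 0) := by

  -- For `d = 0` there is no coordinate from which scalar bounds could be drawn, but all norms
  -- vanish.
  rcases Nat.eq_zero_or_pos d with rfl | hd
  · refine ⟨1, one_pos, 1, one_pos, fun N t ht _ U _ n hn => ?_⟩
    have hτ : 0 ≤ meshSize N t := by linarith [le_meshSize t hn, ht.2.2 n hn]
    have hv : ∀ (v : Vec 0) (z : ℤ), ‖v‖ ≤ 1 * meshSize N t ^ z := fun v z => by
      rw [Subsingleton.elim v 0, norm_zero, one_mul]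
      exact zpow_nonneg hτ z
    refine ⟨?_, fun s _ => ⟨hv _ _, hv _ _⟩, fun _ s _ => hv _ _⟩
    rw [show (fun s => u s - U s) = fun _ => 0 from Subsingleton.elim _ _]
    exact differentiableOn_const 0
  obtain ⟨x, hx, hxs⟩ := rIA_spec hQ hA (r - k)
  obtain ⟨y, hy, hys⟩ := rIA_spec hQ hA 0
  obtain ⟨z, hz, hzs⟩ := rEx_spec hQ
  obtain ⟨m, hmr, hmx, hbasic, σ, himp, hσ⟩ := order_arith r x y z _ _ _ hx hy hz
  obtain ⟨C, hC, h₀, hh₀, hh₀1, hloc⟩ := exists_local_error hkr ⟨0, hd⟩ hQ hA hT hf hu hInt hSupInt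
    hSup hDiff hmr (hxs m hmx)
  obtain ⟨G, hG⟩ : ∃ G, G = Real.exp (C * T) := ⟨_, rfl⟩
  have hG0 : 0 < G := hG ▸ Real.exp_pos _
  -- `G` bounds the accumulated nodal error, the `1` beside it the local contribution; the last `1`
  -- makes the constant positive when `C = 0`.
  refine ⟨h₀, hh₀, C * (G + 1) + 1, by positivity, fun N t ht hτ U hU n hn => ?_⟩
  -- Both orders are finite, being minima with `r` and `r + 1`, so the default `0` is never taken.
  have hbo : (basicOrder r k Q A).untopD 0 = (m : ℤ) := by
    rw [basicOrder, hbasic, WithTop.untopD_coe]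
  have hio : (improvedOrder r k Q A).untopD 0 = σ := by
    rw [improvedOrder, himp, WithTop.untopD_coe]
  rw [hbo, hio, zpow_natCast]
  obtain ⟨τ, hτe⟩ : ∃ τ, τ = meshSize N t := ⟨_, rfl⟩
  rw [← hτe] at hτ ⊢
  have hle : ∀ l < N, t (l + 1) - t l ≤ τ := fun l hl => hτe ▸ le_meshSize t hl
  have hτ0 : 0 < τ := by linarith [hle n hn, ht.2.2 n hn]
  have hτ1 : τ ≤ 1 := hτ.trans hh₀1
  have hleft : ∀ l ≤ N, t₀ ≤ t l := fun l hl => ht.1 ▸ ht.mono (Nat.zero_le l) hl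
  have hright : ∀ l ≤ N, t l ≤ t₀ + T := fun l hl => ht.2.1 ▸ ht.mono hl le_rfl
  have hpow : ∀ l < N, ∀ j : ℕ, (t (l + 1) - t l) ^ j ≤ τ ^ j := fun l hl j =>
    pow_le_pow_left₀ (by linarith [ht.2.2 l hl]) (hle l hl) j
  choose! p hUp hp using hU.2
  have hE := fun l (hl : l < N) => hloc (t l) (t (l + 1)) (hleft l hl.le) (ht.2.2 l hl)
    (hright (l + 1) hl) ((hle l hl).trans hτ) _ _ (hp l hl)
  -- The intervals are closed on the right, so the left value of the next step is the end value of
  -- `p l`.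
  have hend : ∀ l < N, U (t (l + 1)) = p l (t (l + 1)) := fun l hl =>
    hUp l hl (right_mem_Ioc.2 (ht.2.2 l hl))
  -- Stated for a general exponent, to be used with `m` and with `m + 1`.
  have hglobal : ∀ j : ℕ, (∀ l < N, ‖u (t (l + 1)) - p l (t (l + 1))‖ ≤ ‖u (t l) - U (t l)‖
      + C * (t (l + 1) - t l) * (‖u (t l) - U (t l)‖ + (t (l + 1) - t l) ^ j)) →
      ‖u (t n) - U (t n)‖ ≤ G * τ ^ j := by
    intro j hj
    have h1 := mesh_gronwall (E := fun l => ‖u (t l) - U (t l)‖) (t := t) (N := N) hC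
      (pow_nonneg hτ0.le j) (fun l hl => (ht.2.2 l hl).le) (fun l => norm_nonneg _)
      (by rw [hU.1, ht.1, hu.1, sub_self, norm_zero]) (fun l hl => by
        rw [hend l hl]
        refine (hj l hl).trans ?_
        have h2 : 0 ≤ C * (t (l + 1) - t l) := mul_nonneg hC (by linarith [ht.2.2 l hl])
        have h3 := hpow l hl j
        gcongr) n hn.le
    refine h1.trans (mul_le_mul_of_nonneg_right ?_ (pow_nonneg hτ0.le j))
    rw [hG, Real.exp_le_exp]
    refine mul_le_mul_of_nonneg_left ?_ hC
    linarith [hright n hn.le, ht.1]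
  have hfin : ∀ {v ε : ℝ} (i j : ℕ), i ≤ j → ε ≤ G * τ ^ i → v ≤ C * (ε + (t (n + 1) - t n) ^ j) →
      v ≤ (C * (G + 1) + 1) * τ ^ i := by
    intro v ε i j hij hε hv
    have h1 := (hpow n hn j).trans (pow_le_pow_of_le_one hτ0.le hτ1 hij)
    have h2 : C * (ε + (t (n + 1) - t n) ^ j) ≤ C * (G * τ ^ i + τ ^ i) := by gcongr
    have h3 : 0 ≤ τ ^ i := pow_nonneg hτ0.le i
    linarith
  have hbase := hglobal m fun l hl => (hE l hl).2.2.1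
  obtain ⟨hval, hder, -, -⟩ := hE n hn
  have hsub : Ioc (t n) (t (n + 1)) ⊆ Icc (t n) (t (n + 1)) := Ioc_subset_Icc_self
  have hderiv : ∀ s ∈ Ioc (t n) (t (n + 1)), HasDerivWithinAt (fun s => u s - U s)
      (f s (u s) - deriv (p n) s) (Ioc (t n) (t (n + 1))) s := by
    intro s hs
    have hs' : s ∈ Icc t₀ (t₀ + T) := Icc_subset_Icc (hleft n hn.le) (hright (n + 1) hn) (hsub hs)
    have h1 := (hu.2 s hs').mono
      (hsub.trans (Icc_subset_Icc (hleft n hn.le) (hright (n + 1) hn)))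
    have h2 := ((hp n hn).poly.contDiff.differentiable one_ne_zero
      s).hasDerivAt.hasDerivWithinAt (s := Ioc (t n) (t (n + 1)))
    exact h1.sub (h2.congr (hUp n hn) (hUp n hn hs))
  have hvalU : ∀ s ∈ Ioc (t n) (t (n + 1)),
      ‖u s - U s‖ ≤ C * (‖u (t n) - U (t n)‖ + (t (n + 1) - t n) ^ (m + 1)) := fun s hs => by
    rw [hUp n hn hs]; exact hval s (hsub hs)
  refine ⟨fun s hs => (hderiv s hs).differentiableWithinAt, fun s hs => ⟨?_, ?_⟩, fun hr s hs => ?_⟩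
  · exact hfin m (m + 1) (Nat.le_succ m) hbase (hvalU s hs)
  · rw [(hderiv s hs).derivWithin (uniqueDiffOn_Ioc _ _ s hs)]
    exact hfin m m le_rfl hbase (hder s (hsub hs))
  -- If the improved order does not exceed `m`, the basic estimate suffices as `τ ≤ 1`; otherwise
  -- the sharper one-step bound is accumulated.
  · rcases hσ hr with hσm | ⟨rfl, hy1, hz1, hz2⟩
    · refine (hfin m (m + 1) (Nat.le_succ m) hbase (hvalU s hs)).trans ?_
      rw [← zpow_natCast]
      exact mul_le_mul_of_nonneg_left (zpow_le_zpow_right_of_le_one₀ hτ0 hτ1 hσm) (by positivity)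
    · have h1 := hglobal (m + 1) fun l hl => (hE l hl).2.2.2 (hzs r hz2) (hzs (m + 1) hz1)
        fun q hq => by
          have := hys (m + 1) hy1 q hq 1 (mem_degreeLT.2
            (degree_one_le.trans_lt (by exact_mod_cast Nat.succ_pos _)))
          simpa using this
      have h2 := hfin (m + 1) (m + 1) le_rfl h1 (hvalU s hs)
      exact_mod_cast h2
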